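/- Manifolds are smooth, finite-dimensional, Hausdorff and second countable; $\mathbb{R}^\times$ denotes either $\mathbb{R}\setminus\{0\}$ or $\mathbb{R}^+$. An action of a Lie group on a manifold $M$ is \emph{principal} if it is the action of a (locally trivial) smooth principal bundle with total space $M$; the base is then the orbit space. Let $(S,\omega)$ be a symplectic manifold and $H\in C^\infty(S)$. For $f\in C^\infty(S)$ let $X_f=X_f^\omega$ be the vector field with $i_{X_f}\omega=df$, and let $\{f,g\}_S=\omega(X_g,X_f)=X_f(g)$. Let $\phi:\mathbb{R}^\times\times S\to S$ be a scaling symmetry, i.e. a principal action with $\phi_s^*\omega=s\,\omega$ and $H\circ\phi_s=sH$ for all $s\in\mathbb{R}^\times$. Let $\Phi:G\times S\to S$ be the action of a Lie group $G$ of a principal $G$-bundle $\wp_S:S\to P=S/G$, with $\Phi_b^*\omega=\omega$ and $H\circ\Phi_b=H$ for all $b\in G$. Assume that $\Phi_b\circ\phi_s=\phi_s\circ\Phi_b$ for all $s,b$ and that the resulting action of $\mathbb{R}^\times\times G$ on $S$ is principal. Then: (1) There are a Poisson bracket $\{\cdot,\cdot\}_P$ on $P$ with $\{f_1,f_2\}_P\circ\wp_S=\{f_1\circ\wp_S,f_2\circ\wp_S\}_S$,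 a function $H^G\in C^\infty(P)$ with $H^G\circ\wp_S=H$, and an action $\phi^P$ of $\mathbb{R}^\times$ on $P$ with $\phi^P_s\circ\wp_S=\wp_S\circ\phi_s$. The action $\phi^P$ is principal, $\{F\circ\phi^P_s,F'\circ\phi^P_s\}_P=s\,\{F,F'\}_P\circ\phi^P_s$ for $F,F'\in C^\infty(P)$, and $H^G\circ\phi^P_s=sH^G$. Let ${\bf p}_P:P\to K=P/\mathbb{R}^\times$ be the corresponding principal bundle, $L=(P\times\mathbb{R})/\mathbb{R}^\times\to K$ its associated line bundle, where $s\cdot(y,t)=(\phi^P_s(y),t/s)$, and $\Gamma(L^*)$ the space of smooth sections of the dual bundle $L^*$. Every homogeneous function $F\in C^\infty(P)$ (i.e. $F\circ\phi^P_s=sF$), in particular $H^G$, induces a section $h_F\in\Gamma(L^*)$ by $h_F({\bf p}_P(y))([y,t])=t\,F(y)$. (2) There is a Kirillov bracket $[\cdot,\cdot]_{L^*}$ on $\Gamma(L^*)$, i.e. a Lie bracket such that for every $h_2\in\Gamma(L^*)$ there is a smooth vector field $X_{h_2}$ on $K$, the symbol of $[\cdot,h_2]_{L^*}$, with $[fh_1,h_2]_{L^*}=f[h_1,h_2]_{L^*}+X_{h_2}(f)h_1$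 for all $h_1\in\Gamma(L^*)$, $f\in C^\infty(K)$, and such that for all homogeneous $H_1,H_2\in C^\infty(P)$ the function $\{H_1,H_2\}_P$ is homogeneous and $[h_{H_1},h_{H_2}]_{L^*}=-h_{\{H_1,H_2\}_P}$. (3) For this bracket, the symbol of $[\cdot,h_{H^G}]_{L^*}$ is unique, the Hamiltonian vector field $X_H^\omega$ is $({\bf p}_P\circ\wp_S)$-projectable, and its projection on $K$ is this symbol: $T({\bf p}_P\circ\wp_S)\circ X_H^\omega=X_{h_{H^G}}\circ{\bf p}_P\circ\wp_S$. -/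

import Mathlib

open scoped Manifold ContDiff Topology

universe u

noncomputable section

/-! ## The multiplicative group of scalings

The scaling group is an open subgroup `Λ` of `ℝˣ`; in the theorem it is either all of `ℝˣ`
or the subgroup of positive units.  As an open subset of `ℝˣ` it is a one-dimensional manifold. -/

instance OpenSubgroup.instChartedSpaceUnitsReal (Λ : OpenSubgroup ℝˣ) : ChartedSpace ℝ Λ :=
  inferInstanceAs (ChartedSpace ℝ (Λ : TopologicalSpace.Opens ℝˣ))

/-- The real number underlying a scaling parameter. -/
def scal {Λ : OpenSubgroup ℝˣ} (s : Λ) : ℝ := ((s : ℝˣ) : ℝ)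

lemma scal_ne_zero {Λ : OpenSubgroup ℝˣ} (s : Λ) : scal s ≠ 0 := (s : ℝˣ).ne_zero

@[simp] lemma scal_one {Λ : OpenSubgroup ℝˣ} : scal (1 : Λ) = 1 := by simp [scal]

@[simp] lemma scal_mul {Λ : OpenSubgroup ℝˣ} (s t : Λ) : scal (s * t) = scal s * scal t := by
  simp [scal]

@[simp] lemma scal_inv {Λ : OpenSubgroup ℝˣ} (s : Λ) : scal s⁻¹ = (scal s)⁻¹ := by
  simp [scal]

/-! ## Smooth actions and principal bundles -/

section Principal

variable {EG HG EM HM EK HK : Type*}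
  [NormedAddCommGroup EG] [NormedSpace ℝ EG] [TopologicalSpace HG]
  [NormedAddCommGroup EM] [NormedSpace ℝ EM] [TopologicalSpace HM]
  [NormedAddCommGroup EK] [NormedSpace ℝ EK] [TopologicalSpace HK]
  {G M K : Type*} [Group G]
  [TopologicalSpace G] [ChartedSpace HG G]
  [TopologicalSpace M] [ChartedSpace HM M]
  [TopologicalSpace K] [ChartedSpace HK K]

/-- `a : G → M → M` is a smooth left action of `G` on the manifold `M`. -/
structure IsSmoothAction (IG : ModelWithCorners ℝ EG HG) (IM : ModelWithCorners ℝ EM HM)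
    (a : G → M → M) : Prop where
  one_act : ∀ x, a 1 x = x
  mul_act : ∀ g g' x, a (g * g') x = a g (a g' x)
  contMDiff : ContMDiff (IG.prod IM) IM ∞ (fun z : G × M => a z.1 z.2)

/-- `p : M → K` is a smooth principal `G`-bundle for the action `a` of `G` on `M`: the fibres of
the surjection `p` are the orbits of `a`, and over a neighbourhood of every point of `K` there is
a `G`-equivariant diffeomorphism from `M` onto the product with `G`.  In particular
`K` is the orbit space `M / G`. -/
structure IsPrincipalBundle (IG : ModelWithCorners ℝ EG HG) (IM : ModelWithCorners ℝ EM HM)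
    (IK : ModelWithCorners ℝ EK HK) (a : G → M → M) (p : M → K) : Prop where
  isSmoothAction : IsSmoothAction IG IM a
  contMDiff : ContMDiff IM IK ∞ p
  surjective : Function.Surjective p
  fiber_iff : ∀ x y, p x = p y ↔ ∃ g, y = a g x
  locally_trivial : ∀ k : K, ∃ (U : Set K) (e : OpenPartialHomeomorph M (K × G)),
    IsOpen U ∧ k ∈ U ∧ e.source = p ⁻¹' U ∧ e.target = U ×ˢ Set.univ ∧
    ContMDiffOn IM (IK.prod IG) ∞ e e.source ∧
    ContMDiffOn (IK.prod IG) IM ∞ e.symm e.target ∧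
    ∀ x ∈ e.source, (e x).1 = p x ∧ ∀ g, (e (a g x)).2 = g * (e x).2

/-- The action of a principal bundle is free. -/
lemma IsPrincipalBundle.eq_one {IG : ModelWithCorners ℝ EG HG} {IM : ModelWithCorners ℝ EM HM}
    {IK : ModelWithCorners ℝ EK HK} {a : G → M → M} {p : M → K}
    (h : IsPrincipalBundle IG IM IK a p) {g : G} {x : M} (hg : a g x = x) : g = 1 := by
  obtain ⟨U, e, -, hk, hs, -, -, -, he⟩ := h.locally_trivial (p x)
  have hx : x ∈ e.source := by rw [hs]; exact hk
  have h1 := (he x hx).2 g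
  rw [hg] at h1
  exact (mul_eq_right.mp h1.symm)

end Principal

/-- A principal action: the action of a smooth principal bundle over some (Hausdorff,
second countable) manifold, i.e. the orbit space is a manifold over which `M` is a principal
bundle. -/
def IsPrincipalAction {EG HG EM HM : Type*}
    [NormedAddCommGroup EG] [NormedSpace ℝ EG] [TopologicalSpace HG]
    [NormedAddCommGroup EM] [NormedSpace ℝ EM] [TopologicalSpace HM]
    {G : Type*} {M : Type u} [Group G]
    [TopologicalSpace G] [ChartedSpace HG G] [TopologicalSpace M] [ChartedSpace HM M]
    (IG : ModelWithCorners ℝ EG HG) (IM : ModelWithCorners ℝ EM HM) (a : G → M → M) : Prop :=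
  ∃ (d : ℕ) (K : Type u) (_ : TopologicalSpace K) (_ : ChartedSpace (EuclideanSpace ℝ (Fin d)) K)
    (p : M → K), IsManifold (𝓡 d) ∞ K ∧ T2Space K ∧ SecondCountableTopology K ∧
      IsPrincipalBundle IG IM (𝓡 d) a p

/-! ## Symplectic manifolds -/

section Symplectic

variable {n : ℕ} {S : Type*} [TopologicalSpace S] [ChartedSpace (EuclideanSpace ℝ (Fin n)) S]

/-- A smooth vector field. -/
def IsSmoothVectorField [IsManifold (𝓡 n) ∞ S] (X : ∀ x : S, TangentSpace (𝓡 n) x) : Prop :=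
  ContMDiff (𝓡 n) (𝓡 n).tangent ∞ (fun x => (⟨x, X x⟩ : TangentBundle (𝓡 n) S))

/-- The derivative `X(f)` of a function along a vector field. -/
def vfDeriv (X : ∀ x : S, TangentSpace (𝓡 n) x) (f : S → ℝ) (x : S) : ℝ :=
  mfderiv (𝓡 n) 𝓘(ℝ, ℝ) f x (X x)

variable (n S) in
/-- A symplectic form: a smooth, closed, non-degenerate `2`-form.  Closedness is expressed by the
invariant formula for the exterior derivative. -/
structure SymplecticForm [IsManifold (𝓡 n) ∞ S] where
  toFun : ∀ x : S, TangentSpace (𝓡 n) x →L[ℝ] TangentSpace (𝓡 n) x →L[ℝ] ℝ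
  smooth : ContMDiff (𝓡 n)
    ((𝓡 n).prod 𝓘(ℝ, EuclideanSpace ℝ (Fin n) →L[ℝ] EuclideanSpace ℝ (Fin n) →L[ℝ] ℝ)) ∞
    (fun x => Bundle.TotalSpace.mk'
      (EuclideanSpace ℝ (Fin n) →L[ℝ] EuclideanSpace ℝ (Fin n) →L[ℝ] ℝ)
      (E := fun x : S => TangentSpace (𝓡 n) x →L[ℝ] TangentSpace (𝓡 n) x →L[ℝ] ℝ) x (toFun x))
  alternating : ∀ x v, toFun x v v = 0
  nondegenerate : ∀ x v, (∀ w, toFun x v w = 0) → v = 0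
  closed : ∀ X Y Z : (∀ x : S, TangentSpace (𝓡 n) x),
    IsSmoothVectorField X → IsSmoothVectorField Y → IsSmoothVectorField Z → ∀ x,
      vfDeriv X (fun y => toFun y (Y y) (Z y)) x
      - vfDeriv Y (fun y => toFun y (X y) (Z y)) x
      + vfDeriv Z (fun y => toFun y (X y) (Y y)) x
      - toFun x (VectorField.mlieBracket (𝓡 n) X Y x) (Z x)
      + toFun x (VectorField.mlieBracket (𝓡 n) X Z x) (Y x)
      - toFun x (VectorField.mlieBracket (𝓡 n) Y Z x) (X x) = 0

variable [IsManifold (𝓡 n) ∞ S]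

/-- The linear map `v ↦ i_v Ω` at a point. -/
def SymplecticForm.flat (Ω : SymplecticForm n S) (x : S) :
    EuclideanSpace ℝ (Fin n) →ₗ[ℝ] Module.Dual ℝ (EuclideanSpace ℝ (Fin n)) where
  toFun v :=
    { toFun := fun w => Ω.toFun x v w
      map_add' := fun w w' => (Ω.toFun x v).map_add w w'
      map_smul' := fun c w => (Ω.toFun x v).map_smul c w }
  map_add' v v' := by
    ext w
    exact DFunLike.congr_fun ((Ω.toFun x).map_add v v') w
  map_smul' c v := by
    ext w
    exact DFunLike.congr_fun ((Ω.toFun x).map_smul c v) w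

lemma SymplecticForm.flat_injective (Ω : SymplecticForm n S) (x : S) :
    Function.Injective (Ω.flat x) := by
  rw [← LinearMap.ker_eq_bot, LinearMap.ker_eq_bot']
  intro v hv
  exact Ω.nondegenerate x v fun w => DFunLike.congr_fun hv w

/-- The Hamiltonian vector field `X_H` of `H`, determined by `i_{X_H} Ω = dH`. -/
def SymplecticForm.hamiltonianVF (Ω : SymplecticForm n S) (H : S → ℝ) (x : S) :
    TangentSpace (𝓡 n) x :=
  ((Ω.flat x).linearEquivOfInjective (Ω.flat_injective x) Subspace.dual_finrank_eq.symm).symm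
    (mfderiv (𝓡 n) 𝓘(ℝ, ℝ) H x : EuclideanSpace ℝ (Fin n) →L[ℝ] ℝ).toLinearMap

lemma SymplecticForm.hamiltonianVF_spec (Ω : SymplecticForm n S) (H : S → ℝ) (x : S)
    (v : TangentSpace (𝓡 n) x) :
    Ω.toFun x (Ω.hamiltonianVF H x) v = mfderiv (𝓡 n) 𝓘(ℝ, ℝ) H x v := by
  have h := ((Ω.flat x).linearEquivOfInjective (Ω.flat_injective x)
    Subspace.dual_finrank_eq.symm).apply_symm_apply
    (mfderiv (𝓡 n) 𝓘(ℝ, ℝ) H x : EuclideanSpace ℝ (Fin n) →L[ℝ] ℝ).toLinearMap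
  rw [LinearMap.linearEquivOfInjective_apply] at h
  exact DFunLike.congr_fun h v

/-- The Poisson bracket of the symplectic form, `{f, g} = Ω(X_g, X_f) = X_f(g)`. -/
def SymplecticForm.poisson (Ω : SymplecticForm n S) (f g : S → ℝ) (x : S) : ℝ :=
  Ω.toFun x (Ω.hamiltonianVF g x) (Ω.hamiltonianVF f x)

/-- `a^* Ω = c Ω`. -/
def SymplecticForm.PullbackEq (Ω : SymplecticForm n S) (a : S → S) (c : ℝ) : Prop :=
  ∀ x (v w : TangentSpace (𝓡 n) x),
    Ω.toFun (a x) (mfderiv (𝓡 n) (𝓡 n) a x v) (mfderiv (𝓡 n) (𝓡 n) a x w) = c * Ω.toFun x v w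

/-- A scaling symmetry of the Hamiltonian system `(S, Ω, H)`: a principal action of the scaling
group for which `Ω` and `H` are homogeneous of degree one. -/
structure IsScalingSymmetry (Ω : SymplecticForm n S) (H : S → ℝ) {Λ : OpenSubgroup ℝˣ}
    (φ : Λ → S → S) : Prop where
  principal : IsPrincipalAction 𝓘(ℝ, ℝ) (𝓡 n) φ
  pullback : ∀ s, Ω.PullbackEq (φ s) (scal s)
  homogeneous : ∀ s x, H (φ s x) = scal s * H x

/-- A symplectic `G`-symmetry of the Hamiltonian system `(S, Ω, H)` with orbit space `P`: the
action of a principal `G`-bundle `q : S → P` that preserves `Ω` and `H`. -/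
structure IsSymplecticSymmetry (Ω : SymplecticForm n S) (H : S → ℝ) (g m : ℕ)
    {G P : Type*} [Group G]
    [TopologicalSpace G] [ChartedSpace (EuclideanSpace ℝ (Fin g)) G]
    [TopologicalSpace P] [ChartedSpace (EuclideanSpace ℝ (Fin m)) P]
    (Φ : G → S → S) (q : S → P) : Prop where
  principal : IsPrincipalBundle (𝓡 g) (𝓡 n) (𝓡 m) Φ q
  pullback : ∀ b, Ω.PullbackEq (Φ b) 1
  invariant : ∀ b x, H (Φ b x) = H x

end Symplectic

/-! ## Poisson manifolds -/

/-- A Poisson bracket on a manifold: a Lie bracket on smooth functions that is a derivation in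
each argument. -/
structure PoissonBracket (m : ℕ) (P : Type*) [TopologicalSpace P]
    [ChartedSpace (EuclideanSpace ℝ (Fin m)) P] where
  bracket : C^∞⟮𝓡 m, P; ℝ⟯ →ₗ[ℝ] C^∞⟮𝓡 m, P; ℝ⟯ →ₗ[ℝ] C^∞⟮𝓡 m, P; ℝ⟯
  self_eq_zero : ∀ f, bracket f f = 0
  jacobi : ∀ f₁ f₂ f₃, bracket f₁ (bracket f₂ f₃) + bracket f₂ (bracket f₃ f₁)
    + bracket f₃ (bracket f₁ f₂) = 0
  leibniz : ∀ f f₁ f₂, bracket (f * f₁) f₂ = f * bracket f₁ f₂ + bracket f f₂ * f₁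

/-- Homogeneous functions (of degree one) for an action of the scaling group. -/
def IsHomogeneous {Λ : OpenSubgroup ℝˣ} {M : Type*} (φ : Λ → M → M) (H : M → ℝ) : Prop :=
  ∀ s x, H (φ s x) = scal s * H x

/-- A scaling symmetry of the Poisson Hamiltonian system `(P, {·,·}, H)`: a principal action of
the scaling group with `{F ∘ φ_s, F' ∘ φ_s} = s ({F, F'} ∘ φ_s)` and `H ∘ φ_s = s H`.
The functions `F ∘ φ_s` are written as smooth functions `F₁`. -/
structure PoissonBracket.IsScalingSymmetry {m : ℕ} {P : Type*} [TopologicalSpace P]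
    [ChartedSpace (EuclideanSpace ℝ (Fin m)) P] (B : PoissonBracket m P)
    (H : C^∞⟮𝓡 m, P; ℝ⟯) {Λ : OpenSubgroup ℝˣ} (φ : Λ → P → P) : Prop where
  principal : IsPrincipalAction 𝓘(ℝ, ℝ) (𝓡 m) φ
  homogeneous_bracket : ∀ (s : Λ) (F F' F₁ F₁' : C^∞⟮𝓡 m, P; ℝ⟯),
    (∀ x, F₁ x = F (φ s x)) → (∀ x, F₁' x = F' (φ s x)) →
    ∀ x, B.bracket F₁ F₁' x = scal s * B.bracket F F' (φ s x)
  homogeneous : IsHomogeneous φ H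

/-! ## The line bundle associated with a principal bundle of the scaling group -/

section LineBundle

variable {m d : ℕ} {M K : Type*} {Λ : OpenSubgroup ℝˣ}
  [TopologicalSpace M] [ChartedSpace (EuclideanSpace ℝ (Fin m)) M]
  [TopologicalSpace K] [ChartedSpace (EuclideanSpace ℝ (Fin d)) K]
  {φ : Λ → M → M} {p : M → K}

/-- The orbit relation of the action `s • (x, t) = (φ_s x, t / s)` on `M × ℝ`. -/
def assocSetoid (h : IsPrincipalBundle 𝓘(ℝ, ℝ) (𝓡 m) (𝓡 d) φ p) : Setoid (M × ℝ) where
  r z w := ∃ s : Λ, w = (φ s z.1, z.2 / scal s)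
  iseqv :=
    { refl := fun z => ⟨1, by simp [h.isSmoothAction.one_act]⟩
      symm := by
        rintro z w ⟨s, rfl⟩
        refine ⟨s⁻¹, Prod.ext ?_ ?_⟩
        · simp [← h.isSmoothAction.mul_act, h.isSmoothAction.one_act]
        · simp [scal_ne_zero]
      trans := by
        rintro z w u ⟨s, rfl⟩ ⟨t, rfl⟩
        refine ⟨t * s, Prod.ext ?_ ?_⟩
        · simp [h.isSmoothAction.mul_act]
        · simp [div_div, mul_comm] }

/-- The total space `L = (M × ℝ) / Λ` of the line bundle associated with `p : M → K`. -/
def LineTotal (h : IsPrincipalBundle 𝓘(ℝ, ℝ) (𝓡 m) (𝓡 d) φ p) : Type _ :=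
  Quotient (assocSetoid h)

/-- The quotient map `M × ℝ → L`. -/
def LineTotal.mk (h : IsPrincipalBundle 𝓘(ℝ, ℝ) (𝓡 m) (𝓡 d) φ p) (x : M) (t : ℝ) :
    LineTotal h :=
  Quotient.mk (assocSetoid h) (x, t)

lemma LineTotal.mk_eq_iff (h : IsPrincipalBundle 𝓘(ℝ, ℝ) (𝓡 m) (𝓡 d) φ p) {x y : M} {t u : ℝ} :
    LineTotal.mk h x t = LineTotal.mk h y u ↔ ∃ s : Λ, y = φ s x ∧ u = t / scal s := by
  exact (Quotient.eq (r := assocSetoid h)).trans (exists_congr fun s => Prod.ext_iff)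

/-- The projection `L → K`. -/
def LineTotal.proj (h : IsPrincipalBundle 𝓘(ℝ, ℝ) (𝓡 m) (𝓡 d) φ p) : LineTotal h → K :=
  Quotient.lift (fun z => p z.1) (by
    rintro z w ⟨s, rfl⟩
    exact (h.fiber_iff _ _).2 ⟨s, rfl⟩)

/-- The fibre `L_k` of the associated line bundle. -/
def LineFiber (h : IsPrincipalBundle 𝓘(ℝ, ℝ) (𝓡 m) (𝓡 d) φ p) (k : K) : Type _ :=
  {l : LineTotal h // LineTotal.proj h l = k}

/-- The class `[x, t]` in the fibre over `p x`. -/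
def LineFiber.mk (h : IsPrincipalBundle 𝓘(ℝ, ℝ) (𝓡 m) (𝓡 d) φ p) (x : M) (t : ℝ) :
    LineFiber h (p x) :=
  ⟨LineTotal.mk h x t, rfl⟩

lemma LineFiber.mkAt_bijective (h : IsPrincipalBundle 𝓘(ℝ, ℝ) (𝓡 m) (𝓡 d) φ p) {k : K} {x : M}
    (hx : p x = k) :
    Function.Bijective (fun t : ℝ => (⟨LineTotal.mk h x t, hx⟩ : LineFiber h k)) := by
  constructor
  · intro t u htu
    obtain ⟨s, hs, hu⟩ := (LineTotal.mk_eq_iff h).1 (Subtype.ext_iff.1 htu)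
    have : s = 1 := h.eq_one hs.symm
    simpa [this] using hu.symm
  · rintro ⟨l, hl⟩
    induction l using Quotient.inductionOn with
    | h z =>
      obtain ⟨y, u⟩ := z
      obtain ⟨s, hs⟩ := (h.fiber_iff x y).1 (hx.trans hl.symm)
      refine ⟨u * scal s, Subtype.ext ?_⟩
      exact (LineTotal.mk_eq_iff h).2 ⟨s, hs, by field_simp [scal_ne_zero s]⟩

/-- The bijection `t ↦ [x, t]` from `ℝ` onto the fibre over `k`, for a chosen point `x` over `k`;
the vector space structure of the fibre is transported along it, and does not depend on the
choice: see `LineFiber.mk_add` and `LineFiber.mk_smul`. -/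
def LineFiber.equiv (h : IsPrincipalBundle 𝓘(ℝ, ℝ) (𝓡 m) (𝓡 d) φ p) (k : K) :
    LineFiber h k ≃ ℝ :=
  (Equiv.ofBijective _ (LineFiber.mkAt_bijective h (h.surjective k).choose_spec)).symm

instance (h : IsPrincipalBundle 𝓘(ℝ, ℝ) (𝓡 m) (𝓡 d) φ p) (k : K) :
    AddCommGroup (LineFiber h k) :=
  (LineFiber.equiv h k).addCommGroup

instance (h : IsPrincipalBundle 𝓘(ℝ, ℝ) (𝓡 m) (𝓡 d) φ p) (k : K) :
    Module ℝ (LineFiber h k) :=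
  (LineFiber.equiv h k).module ℝ

/-- The linear version of `LineFiber.equiv`. -/
def LineFiber.linearEquiv (h : IsPrincipalBundle 𝓘(ℝ, ℝ) (𝓡 m) (𝓡 d) φ p) (k : K) :
    LineFiber h k ≃ₗ[ℝ] ℝ :=
  (LineFiber.equiv h k).linearEquiv ℝ

/-- If `x = φ_s x₀` with `x₀` the chosen point over `p x`, then `[x, t] = [x₀, s t]`. -/
lemma LineFiber.linearEquiv_mk (h : IsPrincipalBundle 𝓘(ℝ, ℝ) (𝓡 m) (𝓡 d) φ p) (x : M) :
    ∃ s : Λ, x = φ s (h.surjective (p x)).choose ∧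
      ∀ t, LineFiber.linearEquiv h (p x) (LineFiber.mk h x t) = scal s * t := by
  obtain ⟨s, hs⟩ := (h.fiber_iff (h.surjective (p x)).choose x).1 (h.surjective (p x)).choose_spec
  refine ⟨s, hs, fun t => ?_⟩
  change LineFiber.equiv h (p x) (LineFiber.mk h x t) = _
  refine (Equiv.symm_apply_eq _).2 (Subtype.ext ?_)
  exact ((LineTotal.mk_eq_iff h).2 ⟨s, hs, by field_simp [scal_ne_zero s]⟩).symm

lemma LineFiber.mk_add (h : IsPrincipalBundle 𝓘(ℝ, ℝ) (𝓡 m) (𝓡 d) φ p) (x : M) (t u : ℝ) :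
    LineFiber.mk h x (t + u) = LineFiber.mk h x t + LineFiber.mk h x u := by
  obtain ⟨s, -, hs⟩ := LineFiber.linearEquiv_mk h x
  apply (LineFiber.linearEquiv h (p x)).injective
  rw [map_add, hs, hs, hs, mul_add]

lemma LineFiber.mk_smul (h : IsPrincipalBundle 𝓘(ℝ, ℝ) (𝓡 m) (𝓡 d) φ p) (x : M) (c t : ℝ) :
    LineFiber.mk h x (c * t) = c • LineFiber.mk h x t := by
  obtain ⟨s, -, hs⟩ := LineFiber.linearEquiv_mk h x
  apply (LineFiber.linearEquiv h (p x)).injective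
  rw [map_smul, hs, hs, smul_eq_mul]
  ring

/-- Smoothness of a section `h` of the dual bundle `L^*`: its values on the local frames
`k ↦ [σ k, 1]` of `L` given by the smooth local sections `σ` of `p : M → K` are smooth functions.
(These frames are the ones that define the smooth vector bundle structure of `L`.) -/
def IsSmoothDualSection (hp : IsPrincipalBundle 𝓘(ℝ, ℝ) (𝓡 m) (𝓡 d) φ p)
    (h : ∀ k, Module.Dual ℝ (LineFiber hp k)) : Prop :=
  ∀ (U : Set K) (σ : K → M), IsOpen U → ContMDiffOn (𝓡 d) (𝓡 m) ∞ σ U →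
    (∀ k ∈ U, p (σ k) = k) →
    ContMDiffOn (𝓡 d) 𝓘(ℝ, ℝ) ∞ (fun k => h (p (σ k)) (LineFiber.mk hp (σ k) 1)) U

/-- The space `Γ(L^*)` of smooth sections of the dual of the associated line bundle. -/
def dualSections (hp : IsPrincipalBundle 𝓘(ℝ, ℝ) (𝓡 m) (𝓡 d) φ p) :
    Submodule ℝ (∀ k, Module.Dual ℝ (LineFiber hp k)) where
  carrier := {h | IsSmoothDualSection hp h}
  add_mem' := fun ha hb U σ hU hσ hpσ => (ha U σ hU hσ hpσ).add (hb U σ hU hσ hpσ)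
  zero_mem' := fun _ _ _ _ _ => contMDiffOn_const
  smul_mem' := fun _ _ ha U σ hU hσ hpσ => contMDiffOn_const.mul (ha U σ hU hσ hpσ)

/-- The product `f h` of a smooth function on `K` with a section of `L^*`. -/
def funSmul (hp : IsPrincipalBundle 𝓘(ℝ, ℝ) (𝓡 m) (𝓡 d) φ p) (f : C^∞⟮𝓡 d, K; ℝ⟯)
    (h : dualSections hp) : dualSections hp :=
  ⟨fun k => f k • h.1 k, fun U σ hU hσ hpσ => by
    refine (f.contMDiff.contMDiffOn.mul (h.2 U σ hU hσ hpσ)).congr fun k hk => ?_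
    simp [hpσ k hk]⟩

/-- The section `h_H` of `L^*` given by a smooth homogeneous function `H` on `M`; it is determined
by `h_H(p x)[x, t] = t H(x)`: see `sectionOf_apply`. -/
def sectionOf (hp : IsPrincipalBundle 𝓘(ℝ, ℝ) (𝓡 m) (𝓡 d) φ p) (H : C^∞⟮𝓡 m, M; ℝ⟯)
    (hH : IsHomogeneous φ H) : dualSections hp :=
  ⟨fun k => H (hp.surjective k).choose • (LineFiber.linearEquiv hp k).toLinearMap,
    fun U σ _ hσ _ => by
      refine (H.contMDiff.comp_contMDiffOn hσ).congr fun k _ => ?_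
      obtain ⟨s, hs, hs'⟩ := LineFiber.linearEquiv_mk hp (σ k)
      have h1 : H (σ k) = scal s * H (hp.surjective (p (σ k))).choose := by
        conv_lhs => rw [hs]
        exact hH _ _
      simp [hs', h1, mul_comm]⟩

lemma sectionOf_apply (hp : IsPrincipalBundle 𝓘(ℝ, ℝ) (𝓡 m) (𝓡 d) φ p) (H : C^∞⟮𝓡 m, M; ℝ⟯)
    (hH : IsHomogeneous φ H) (x : M) (t : ℝ) :
    (sectionOf hp H hH).1 (p x) (LineFiber.mk hp x t) = t * H x := by
  obtain ⟨s, hs, hs'⟩ := LineFiber.linearEquiv_mk hp x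
  have h1 : H x = scal s * H (hp.surjective (p x)).choose := by
    conv_lhs => rw [hs]
    exact hH _ _
  simp only [sectionOf, LinearMap.smul_apply, LinearEquiv.coe_coe, hs', h1, smul_eq_mul]
  ring

/-! ## Kirillov brackets -/

/-- `X` is a symbol of the operator `D = [·, h₂]` on `Γ(L^*)`: `D(f h₁) = f D(h₁) + X(f) h₁`. -/
def IsSymbol (hp : IsPrincipalBundle 𝓘(ℝ, ℝ) (𝓡 m) (𝓡 d) φ p)
    (D : dualSections hp → dualSections hp) (X : ∀ k : K, TangentSpace (𝓡 d) k) : Prop :=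
  ∀ (f : C^∞⟮𝓡 d, K; ℝ⟯) (h₁ : dualSections hp) (k : K),
    (D (funSmul hp f h₁)).1 k = f k • (D h₁).1 k + vfDeriv X f k • h₁.1 k

/-- A Kirillov bracket on `Γ(L^*)`: a Lie bracket such that each `[·, h₂]` is a derivation, with a
smooth vector field on `K` as its symbol. -/
structure KirillovBracket [IsManifold (𝓡 d) ∞ K]
    (hp : IsPrincipalBundle 𝓘(ℝ, ℝ) (𝓡 m) (𝓡 d) φ p) where
  bracket : dualSections hp →ₗ[ℝ] dualSections hp →ₗ[ℝ] dualSections hp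
  self_eq_zero : ∀ h, bracket h h = 0
  jacobi : ∀ h₁ h₂ h₃, bracket h₁ (bracket h₂ h₃) + bracket h₂ (bracket h₃ h₁)
    + bracket h₃ (bracket h₁ h₂) = 0
  derivation : ∀ h₂, ∃ X : ∀ k : K, TangentSpace (𝓡 d) k,
    IsSmoothVectorField X ∧ IsSymbol hp (fun h₁ => bracket h₁ h₂) X

end LineBundle

end

noncomputable section

/-! Everything rests on one computation: a diffeomorphism `a` with `a^*ω = cω` satisfies `{f ∘ a, g
∘ a} = c {f, g} ∘ a`, equivalently `a_* X_{f ∘ a} = c X_f`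
(`SymplecticForm.PullbackEq.mfderiv_hamiltonianVF`, `SymplecticForm.PullbackEq.poisson_comp`).

For `a = Φ_b`, `c = 1`, brackets of `G`-invariant functions are `G`-invariant, so the bracket
descends to `P` (`exists_reduced_poissonBracket`); its Jacobi identity is `dω = 0` evaluated on
Hamiltonian fields. For `a = φ_s`, `c = s`, the reduced bracket scales by `s`; if `F ∘ φ_s = sF` and
`F' ∘ φ_s = sF'`, then `s²{F, F'} = s {F, F'} ∘ φ_s`, so homogeneous functions form a Lie algebra.
The reduced action is principal because its orbit space is that of the joint action, whose local
trivializations descend (`IsPrincipalBundle.reduction`).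

Since `[y, 1]` spans the fibre of `L` over `p y`, a section `h` of `L^*` is the same thing as the
homogeneous function `y ↦ h(p y)[y, 1]`. The Kirillov bracket is `-{·,·}_P` carried over by this
identification (`kirillovOf`). The Leibniz rule `-{f F₁, F₂} = f (-{F₁, F₂}) + {F₂, f} F₁`, with `f`
pulled back from `K`, exhibits the symbol of `[·, h_{F₂}]` as the operator `{F₂, ·}` on basic
functions.

That this operator is a vector field on `K` is the projectability of the Hamiltonian field
(`exists_projected_hamiltonianVF`): if `a^*ω = cω` and `f ∘ a = cf` with the same `c`, the factors
cancel and `a_* X_f = X_f`. Thus the image of `X_{F ∘ q}` in `TK` is constant along the orbits of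
both actions, hence along the fibres of `p ∘ q`. The projected field is by construction the symbol,
which gives (3). The symbol is unique because `L^*` has a section that is nonzero at any given point
and smooth functions separate tangent vectors. -/

/-- The Lie bracket of two vector fields on a vector space acts on functions as the commutator of
the directional derivatives. -/
lemma fderiv_lieBracket {E : Type*} [NormedAddCommGroup E] [NormedSpace ℝ E] {V W : E → E}
    {f : E → ℝ} {x : E} (hV : DifferentiableAt ℝ V x) (hW : DifferentiableAt ℝ W x)
    (hf : ContDiffAt ℝ 2 f x) :
    fderiv ℝ f x (VectorField.lieBracket ℝ V W x) =
      fderiv ℝ (fun y => fderiv ℝ f y (W y)) x (V x) -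
        fderiv ℝ (fun y => fderiv ℝ f y (V y)) x (W x) := by
  have h1 : DifferentiableAt ℝ (fderiv ℝ f) x :=
    (hf.fderiv_right (m := 1) (by norm_num)).differentiableAt one_ne_zero
  have hs : IsSymmSndFDerivAt ℝ f x := hf.isSymmSndFDerivAt (by simp)
  rw [fderiv_clm_apply h1 hW, fderiv_clm_apply h1 hV, VectorField.lieBracket]
  simp only [map_sub, add_apply, ContinuousLinearMap.comp_apply,
    ContinuousLinearMap.flip_apply]
  -- The second-derivative terms cancel by symmetry.
  rw [hs.eq (V x) (W x)]
  ring

/-! ### Vector fields in charts, and their bracket as a commutator of derivations -/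

section VectorFields

variable {n : ℕ} {S : Type*} [TopologicalSpace S] [ChartedSpace (EuclideanSpace ℝ (Fin n)) S]
  [IsManifold (𝓡 n) ∞ S]

/-- The derivative of a smooth function along a smooth vector field is smooth. -/
lemma contMDiff_vfDeriv {X : ∀ x : S, TangentSpace (𝓡 n) x} (hX : IsSmoothVectorField X)
    {f : S → ℝ} (hf : ContMDiff (𝓡 n) 𝓘(ℝ, ℝ) ∞ f) :
    ContMDiff (𝓡 n) 𝓘(ℝ, ℝ) ∞ (vfDeriv X f) := by
  have h1 : ContMDiff (𝓡 n) 𝓘(ℝ, ℝ).tangent ∞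
      (fun x => tangentMap (𝓡 n) 𝓘(ℝ, ℝ) f ⟨x, X x⟩) :=
    (hf.contMDiff_tangentMap (m := ∞) le_rfl).comp hX
  exact (contMDiff_snd_tangentBundle_modelSpace ℝ 𝓘(ℝ, ℝ)).comp h1

/-- A vector field in the chart at `x`. -/
def vfInChart (X : ∀ x : S, TangentSpace (𝓡 n) x) (x : S) :
    EuclideanSpace ℝ (Fin n) → EuclideanSpace ℝ (Fin n) :=
  VectorField.mpullbackWithin 𝓘(ℝ, EuclideanSpace ℝ (Fin n)) (𝓡 n) (extChartAt (𝓡 n) x).symm X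
    (Set.range (𝓡 n))

lemma differentiableAt_vfInChart {X : ∀ x : S, TangentSpace (𝓡 n) x}
    (hX : IsSmoothVectorField X) (x : S) :
    DifferentiableAt ℝ (vfInChart X x) (extChartAt (𝓡 n) x x) := by
  have h1 : DifferentiableWithinAt ℝ (vfInChart X x)
      ((extChartAt (𝓡 n) x).symm ⁻¹' Set.univ ∩ Set.range (𝓡 n)) (extChartAt (𝓡 n) x x) :=
    MDifferentiableWithinAt.differentiableWithinAt_mpullbackWithin_vectorField
      ((hX x).mdifferentiableAt (by simp)).mdifferentiableWithinAt
  rwa [Set.preimage_univ, Set.univ_inter, (𝓡 n).range_eq_univ, differentiableWithinAt_univ] at h1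

lemma ContMDiff.contDiffAt_comp_extChartAt_symm {f : S → ℝ}
    (hf : ContMDiff (𝓡 n) 𝓘(ℝ, ℝ) ∞ f) (x : S) {y : EuclideanSpace ℝ (Fin n)}
    (hy : y ∈ (extChartAt (𝓡 n) x).target) :
    ContDiffAt ℝ ∞ (f ∘ (extChartAt (𝓡 n) x).symm) y := by
  have h1 : ContMDiffAt 𝓘(ℝ, EuclideanSpace ℝ (Fin n)) (𝓡 n) ∞ (extChartAt (𝓡 n) x).symm y :=
    (contMDiffOn_extChartAt_symm x).contMDiffAt ((isOpen_extChartAt_target x).mem_nhds hy)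
  exact contMDiffAt_iff_contDiffAt.1 ((hf _).comp y h1)

/-- The field in the chart is `X` moved by the inverse of the differential of the inverse chart, and
the chain rule cancels that differential. -/
lemma fderiv_vfInChart (X : ∀ x : S, TangentSpace (𝓡 n) x) {f : S → ℝ}
    (hf : ContMDiff (𝓡 n) 𝓘(ℝ, ℝ) ∞ f) (x : S) {y : EuclideanSpace ℝ (Fin n)}
    (hy : y ∈ (extChartAt (𝓡 n) x).target) :
    fderiv ℝ (f ∘ (extChartAt (𝓡 n) x).symm) y (vfInChart X x y) =
      vfDeriv X f ((extChartAt (𝓡 n) x).symm y) := by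
  have h2 : Set.range (𝓡 n) = Set.univ := (𝓡 n).range_eq_univ
  have hd := mdifferentiableWithinAt_extChartAt_symm (I := 𝓡 n) hy
  have hi := isInvertible_mfderivWithin_extChartAt_symm (I := 𝓡 n) hy
  unfold vfInChart
  rw [VectorField.mpullbackWithin_apply]
  rw [h2] at hd hi ⊢
  rw [mfderivWithin_univ] at hi ⊢
  rw [mdifferentiableWithinAt_univ] at hd
  rw [← mfderiv_eq_fderiv, mfderiv_comp y ((hf _).mdifferentiableAt (by simp)) hd]
  exact congrArg (mfderiv (𝓡 n) 𝓘(ℝ, ℝ) f ((extChartAt (𝓡 n) x).symm y))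
    (hi.self_apply_inverse _)

/-- The manifold Lie bracket is the chart bracket moved back by the inverse of the differential of
the chart; this converts its action on `f` into a Fréchet derivative. -/
lemma mfderiv_inverse_extChartAt {f : S → ℝ}
    (hf : ContMDiff (𝓡 n) 𝓘(ℝ, ℝ) ∞ f) (x : S) (v : EuclideanSpace ℝ (Fin n)) :
    mfderiv (𝓡 n) 𝓘(ℝ, ℝ) f x ((mfderiv (𝓡 n) 𝓘(ℝ, EuclideanSpace ℝ (Fin n))
      (extChartAt (𝓡 n) x) x).inverse v) =
      fderiv ℝ (f ∘ (extChartAt (𝓡 n) x).symm) (extChartAt (𝓡 n) x x) v := by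
  have hi := isInvertible_mfderiv_extChartAt (I := 𝓡 n) (mem_extChartAt_source (I := 𝓡 n) x)
  have he : f =ᶠ[𝓝 x] (f ∘ (extChartAt (𝓡 n) x).symm) ∘ extChartAt (𝓡 n) x := by
    filter_upwards [extChartAt_source_mem_nhds (I := 𝓡 n) x] with y hy
    exact congrArg f ((extChartAt (𝓡 n) x).left_inv hy).symm
  have hd : MDifferentiableAt 𝓘(ℝ, EuclideanSpace ℝ (Fin n)) 𝓘(ℝ, ℝ)
      (f ∘ (extChartAt (𝓡 n) x).symm) (extChartAt (𝓡 n) x x) :=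
    ((ContMDiff.contDiffAt_comp_extChartAt_symm hf x (mem_extChartAt_target x)).differentiableAt
      (by simp)).mdifferentiableAt
  rw [he.mfderiv_eq, mfderiv_comp x hd (mdifferentiableAt_extChartAt (mem_chart_source _ x)),
    ← mfderiv_eq_fderiv]
  exact congrArg (mfderiv 𝓘(ℝ, EuclideanSpace ℝ (Fin n)) 𝓘(ℝ, ℝ)
    (f ∘ (extChartAt (𝓡 n) x).symm) (extChartAt (𝓡 n) x x)) (hi.self_apply_inverse v)

/-- The Lie bracket of vector fields acts on functions as a commutator. -/
lemma vfDeriv_mlieBracket {X Y : ∀ x : S, TangentSpace (𝓡 n) x} (hX : IsSmoothVectorField X)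
    (hY : IsSmoothVectorField Y) {f : S → ℝ} (hf : ContMDiff (𝓡 n) 𝓘(ℝ, ℝ) ∞ f) (x : S) :
    vfDeriv (VectorField.mlieBracket (𝓡 n) X Y) f x =
      vfDeriv X (vfDeriv Y f) x - vfDeriv Y (vfDeriv X f) x := by
  have key : ∀ Z : (∀ x : S, TangentSpace (𝓡 n) x),
      vfDeriv Z f ∘ (extChartAt (𝓡 n) x).symm =ᶠ[𝓝 (extChartAt (𝓡 n) x x)]
        fun y => fderiv ℝ (f ∘ (extChartAt (𝓡 n) x).symm) y (vfInChart Z x y) := by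
    intro Z
    filter_upwards [extChartAt_target_mem_nhds (I := 𝓡 n) x] with y hy
    exact (fderiv_vfInChart Z hf x hy).symm
  have h3 : ∀ Z W : (∀ x : S, TangentSpace (𝓡 n) x), IsSmoothVectorField W →
      vfDeriv Z (vfDeriv W f) x =
      fderiv ℝ (fun y => fderiv ℝ (f ∘ (extChartAt (𝓡 n) x).symm) y (vfInChart W x y))
        (extChartAt (𝓡 n) x x) (vfInChart Z x (extChartAt (𝓡 n) x x)) := by
    intro Z W hW
    have := fderiv_vfInChart Z (contMDiff_vfDeriv hW hf) x (mem_extChartAt_target x)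
    rw [extChartAt_to_inv] at this
    rw [← this, (key W).fderiv_eq]
  have h4 : vfDeriv (VectorField.mlieBracket (𝓡 n) X Y) f x =
      fderiv ℝ (f ∘ (extChartAt (𝓡 n) x).symm) (extChartAt (𝓡 n) x x)
        (VectorField.lieBracket ℝ (vfInChart X x) (vfInChart Y x) (extChartAt (𝓡 n) x x)) := by
    rw [← mfderiv_inverse_extChartAt hf, vfDeriv, ← VectorField.mlieBracketWithin_univ,
      VectorField.mlieBracketWithin_apply]
    change mfderiv (𝓡 n) 𝓘(ℝ, ℝ) f x ((mfderiv (𝓡 n) 𝓘(ℝ, EuclideanSpace ℝ (Fin n))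
      (extChartAt (𝓡 n) x) x).inverse (VectorField.lieBracketWithin ℝ (vfInChart X x)
        (vfInChart Y x) ((extChartAt (𝓡 n) x).symm ⁻¹' Set.univ ∩ Set.range (𝓡 n))
        (extChartAt (𝓡 n) x x) :)) = _
    rw [Set.preimage_univ, Set.univ_inter, (𝓡 n).range_eq_univ,
      VectorField.lieBracketWithin_univ]
  rw [h3 X Y hY, h3 Y X hX, h4]
  refine fderiv_lieBracket (differentiableAt_vfInChart hX x) (differentiableAt_vfInChart hY x) ?_
  exact (ContMDiff.contDiffAt_comp_extChartAt_symm hf x (mem_extChartAt_target x)).of_le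
    (by norm_cast)

end VectorFields

/-! ### Smoothness of Hamiltonian fields, the Jacobi identity, conformally symplectic maps -/

section HamiltonianVF

variable {n : ℕ} {S : Type*} [TopologicalSpace S] [ChartedSpace (EuclideanSpace ℝ (Fin n)) S]
  [IsManifold (𝓡 n) ∞ S]

lemma contMDiff_differential {f : S → ℝ} (hf : ContMDiff (𝓡 n) 𝓘(ℝ, ℝ) ∞ f) :
    ContMDiff (𝓡 n) ((𝓡 n).prod 𝓘(ℝ, EuclideanSpace ℝ (Fin n) →L[ℝ] ℝ)) ∞
      (fun x => Bundle.TotalSpace.mk' (EuclideanSpace ℝ (Fin n) →L[ℝ] ℝ)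
        (E := fun x : S => TangentSpace (𝓡 n) x →L[ℝ] ℝ) x (mfderiv (𝓡 n) 𝓘(ℝ, ℝ) f x)) := by
  intro x₀
  rw [contMDiffAt_hom_bundle]
  refine ⟨contMDiffAt_id, ?_⟩
  -- The target `ℝ` is a trivial bundle, so the coordinates of the hom bundle agree with the tangent
  -- coordinates used by `mfderiv_const`.
  have h1 := (hf x₀).mfderiv_const (m := ∞) le_rfl
  refine h1.congr_of_eventuallyEq ?_
  filter_upwards with x
  ext v
  simp only [inTangentCoordinates, ContinuousLinearMap.inCoordinates,
    ContinuousLinearMap.comp_apply, TangentBundle.continuousLinearMapAt_model_space]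
  exact DFunLike.congr_fun (Bundle.Trivial.continuousLinearMapAt_trivialization ℝ S ℝ x) _

/-- A non-degenerate form as an equivalence. -/
def SymplecticForm.equiv (Ω : SymplecticForm n S) (x : S) :
    EuclideanSpace ℝ (Fin n) ≃L[ℝ] (EuclideanSpace ℝ (Fin n) →L[ℝ] ℝ) :=
  (((Ω.flat x).linearEquivOfInjective (Ω.flat_injective x) Subspace.dual_finrank_eq.symm).trans
    LinearMap.toContinuousLinearMap).toContinuousLinearEquiv

/-- In a local trivialization the form becomes a smooth family of invertible operators from `E` to
its dual, and `X_f` is the inverse operator applied to `df`. Inversion of operators is smooth at an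
invertible one. -/
lemma SymplecticForm.isSmoothVectorField_hamiltonianVF (Ω : SymplecticForm n S) {f : S → ℝ}
    (hf : ContMDiff (𝓡 n) 𝓘(ℝ, ℝ) ∞ f) : IsSmoothVectorField (Ω.hamiltonianVF f) := by
  intro x₀
  rw [Bundle.contMDiffAt_totalSpace]
  refine ⟨contMDiffAt_id, ?_⟩
  have h1 := (contMDiff_differential hf x₀)
  rw [Bundle.contMDiffAt_totalSpace] at h1
  have h2 := Ω.smooth x₀
  rw [contMDiffAt_hom_bundle] at h2
  replace h1 := h1.2
  replace h2 := h2.2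
  simp only at h1 h2 ⊢
  set T := trivializationAt (EuclideanSpace ℝ (Fin n)) (TangentSpace (𝓡 n) (M := S)) x₀ with hT
  set T' := trivializationAt (EuclideanSpace ℝ (Fin n) →L[ℝ] ℝ)
    (fun x : S => TangentSpace (𝓡 n) x →L[ℝ] ℝ) x₀ with hT'
  have hx₀ : x₀ ∈ T.baseSet := FiberBundle.mem_baseSet_trivializationAt' x₀
  have hb : T'.baseSet = T.baseSet := by
    rw [hT', hom_trivializationAt_baseSet]; simp [hT]
  -- The coordinate expression of the form is a genuine equivalence, so
  -- `ContinuousLinearMap.inverse` returns its true inverse and not the default value.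
  have key : ∀ x (hx : x ∈ T.baseSet),
      ContinuousLinearMap.inCoordinates (EuclideanSpace ℝ (Fin n)) (TangentSpace (𝓡 n) (M := S))
        (EuclideanSpace ℝ (Fin n) →L[ℝ] ℝ) (fun x : S => TangentSpace (𝓡 n) x →L[ℝ] ℝ)
        x₀ x x₀ x (Ω.toFun x) =
      (((T.continuousLinearEquivAt ℝ x hx).symm.trans (Ω.equiv x)).trans
        (T'.continuousLinearEquivAt ℝ x (hb ▸ hx)) : EuclideanSpace ℝ (Fin n) →L[ℝ] _) := by
    intro x hx
    rw [ContinuousLinearMap.inCoordinates_eq hx (hb ▸ hx)]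
    rfl
  have h3 : ContMDiffAt (𝓡 n) 𝓘(ℝ, EuclideanSpace ℝ (Fin n)) ∞ (fun x =>
      (ContinuousLinearMap.inCoordinates (EuclideanSpace ℝ (Fin n)) (TangentSpace (𝓡 n) (M := S))
        (EuclideanSpace ℝ (Fin n) →L[ℝ] ℝ) (fun x : S => TangentSpace (𝓡 n) x →L[ℝ] ℝ)
        x₀ x x₀ x (Ω.toFun x)).inverse
      (T' ⟨x, mfderiv (𝓡 n) 𝓘(ℝ, ℝ) f x⟩).2) x₀ := by
    refine ContMDiffAt.clm_apply ?_ h1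
    refine ContMDiffAt.comp x₀ (g := ContinuousLinearMap.inverse) ?_ h2
    refine ContDiffAt.contMDiffAt ?_
    apply ContinuousLinearMap.IsInvertible.contDiffAt_map_inverse
    rw [key x₀ hx₀]
    exact ContinuousLinearMap.isInvertible_equiv
  refine h3.congr_of_eventuallyEq ?_
  filter_upwards [T.open_baseSet.mem_nhds hx₀] with x hx
  rw [key x hx, ContinuousLinearMap.inverse_equiv]
  symm
  rw [ContinuousLinearEquiv.coe_coe, ContinuousLinearEquiv.symm_apply_eq]
  change _ = T'.continuousLinearEquivAt ℝ x (hb ▸ hx) (Ω.equiv x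
    ((T.continuousLinearEquivAt ℝ x hx).symm (T ⟨x, Ω.hamiltonianVF f x⟩).2))
  have h4 : (T.continuousLinearEquivAt ℝ x hx).symm (T ⟨x, Ω.hamiltonianVF f x⟩).2 =
      Ω.hamiltonianVF f x := (T.continuousLinearEquivAt ℝ x hx).symm_apply_apply _
  rw [h4]
  have h5 : Ω.equiv x (Ω.hamiltonianVF f x) = mfderiv (𝓡 n) 𝓘(ℝ, ℝ) f x := by
    ext v
    exact Ω.hamiltonianVF_spec f x v
  rw [h5]
  rfl

lemma SymplecticForm.antisymm (Ω : SymplecticForm n S) (x : S) (v w : TangentSpace (𝓡 n) x) :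
    Ω.toFun x v w = -Ω.toFun x w v := by
  have h := Ω.alternating x (v + w)
  simp only [map_add, add_apply, Ω.alternating] at h
  linarith

lemma SymplecticForm.poisson_eq (Ω : SymplecticForm n S) (f g : S → ℝ) :
    Ω.poisson f g = vfDeriv (Ω.hamiltonianVF f) g :=
  funext fun x => Ω.hamiltonianVF_spec g x _

lemma SymplecticForm.poisson_antisymm (Ω : SymplecticForm n S) (f g : S → ℝ) (x : S) :
    Ω.poisson f g x = -Ω.poisson g f x := Ω.antisymm x _ _

lemma SymplecticForm.contMDiff_poisson (Ω : SymplecticForm n S) {f g : S → ℝ}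
    (hf : ContMDiff (𝓡 n) 𝓘(ℝ, ℝ) ∞ f) (hg : ContMDiff (𝓡 n) 𝓘(ℝ, ℝ) ∞ g) :
    ContMDiff (𝓡 n) 𝓘(ℝ, ℝ) ∞ (Ω.poisson f g) := by
  rw [Ω.poisson_eq]
  exact contMDiff_vfDeriv (Ω.isSmoothVectorField_hamiltonianVF hf) hg

/-- Closedness is applied to the three Hamiltonian fields. Both the derivatives of `Ω(X_g, X_h)` and
the bracket terms, by `vfDeriv_mlieBracket`, are iterated Poisson brackets; after antisymmetry one
of each cyclic type remains. -/
lemma SymplecticForm.poisson_jacobi (Ω : SymplecticForm n S) {f g h : S → ℝ}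
    (hf : ContMDiff (𝓡 n) 𝓘(ℝ, ℝ) ∞ f) (hg : ContMDiff (𝓡 n) 𝓘(ℝ, ℝ) ∞ g)
    (hh : ContMDiff (𝓡 n) 𝓘(ℝ, ℝ) ∞ h) (x : S) :
    Ω.poisson f (Ω.poisson g h) x + Ω.poisson g (Ω.poisson h f) x
      + Ω.poisson h (Ω.poisson f g) x = 0 := by
  have hX := Ω.isSmoothVectorField_hamiltonianVF hf
  have hY := Ω.isSmoothVectorField_hamiltonianVF hg
  have hZ := Ω.isSmoothVectorField_hamiltonianVF hh
  have hbr : ∀ {a b c : S → ℝ}, ContMDiff (𝓡 n) 𝓘(ℝ, ℝ) ∞ a → ContMDiff (𝓡 n) 𝓘(ℝ, ℝ) ∞ b →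
      ContMDiff (𝓡 n) 𝓘(ℝ, ℝ) ∞ c →
      Ω.toFun x (VectorField.mlieBracket (𝓡 n) (Ω.hamiltonianVF a) (Ω.hamiltonianVF b) x)
        (Ω.hamiltonianVF c x) =
        -(Ω.poisson a (Ω.poisson b c) x - Ω.poisson b (Ω.poisson a c) x) := by
    intro a b c ha hb hc
    rw [Ω.antisymm, Ω.hamiltonianVF_spec]
    rw [Ω.poisson_eq a, Ω.poisson_eq b, Ω.poisson_eq b, Ω.poisson_eq a]
    exact congrArg _ (vfDeriv_mlieBracket (Ω.isSmoothVectorField_hamiltonianVF ha)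
      (Ω.isSmoothVectorField_hamiltonianVF hb) hc x)
  have h0 := Ω.closed _ _ _ hX hY hZ x
  rw [hbr hf hg hh, hbr hf hh hg, hbr hg hh hf] at h0
  change vfDeriv _ (Ω.poisson h g) x - vfDeriv _ (Ω.poisson h f) x
    + vfDeriv _ (Ω.poisson g f) x - _ + _ - _ = 0 at h0
  simp only [← Ω.poisson_eq] at h0
  have hneg : ∀ a b c : S → ℝ, Ω.poisson a (Ω.poisson b c) x = -Ω.poisson a (Ω.poisson c b) x := by
    intro a b c
    have h6 : Ω.poisson b c = -Ω.poisson c b := funext fun y => Ω.poisson_antisymm b c y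
    rw [h6, Ω.poisson_eq a, Ω.poisson_eq a, vfDeriv, vfDeriv, mfderiv_neg]
    rfl
  linarith [hneg f h g, hneg g h f, hneg h g f]

/-- The Hamiltonian vector field of a pulled back function, for a conformally symplectic map. -/
lemma SymplecticForm.PullbackEq.mfderiv_hamiltonianVF {Ω : SymplecticForm n S} {a b : S → S}
    {c : ℝ} (h : Ω.PullbackEq a c) (ha : ContMDiff (𝓡 n) (𝓡 n) ∞ a)
    (hb : ContMDiff (𝓡 n) (𝓡 n) ∞ b) (hab : ∀ x, a (b x) = x)
    (hba : ∀ x, b (a x) = x) {f : S → ℝ}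
    (hf : ContMDiff (𝓡 n) 𝓘(ℝ, ℝ) ∞ f) (x : S) :
    mfderiv (𝓡 n) (𝓡 n) a x (Ω.hamiltonianVF (fun y => f (a y)) x) =
      c • Ω.hamiltonianVF f (a x) := by
  have hA := (ha x).mdifferentiableAt (by simp)
  have hB := (hb (a x)).mdifferentiableAt (by simp)
  -- The differential of `a` is onto, so nondegeneracy at `a x` need only be tested on vectors
  -- `Ta(v)`, to which the pullback equation applies.
  have hinv : ∀ w : TangentSpace (𝓡 n) (a x), ∃ v : TangentSpace (𝓡 n) x,
      mfderiv (𝓡 n) (𝓡 n) a x v = w := by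
    intro w
    have h1 : mfderiv (𝓡 n) (𝓡 n) (a ∘ b) (a x) w = w := by
      have : a ∘ b = id := funext hab
      rw [this, mfderiv_id]; rfl
    have hA' : MDifferentiableAt (𝓡 n) (𝓡 n) a (b (a x)) := by rwa [hba]
    rw [mfderiv_comp (a x) hA' hB, hba x] at h1
    exact ⟨_, h1⟩
  rw [← sub_eq_zero]
  refine Ω.nondegenerate (a x) _ fun w => ?_
  obtain ⟨v, rfl⟩ := hinv w
  rw [map_sub, map_smul]
  change Ω.toFun (a x) (mfderiv (𝓡 n) (𝓡 n) a x _) (mfderiv (𝓡 n) (𝓡 n) a x v)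
    - c * Ω.toFun (a x) (Ω.hamiltonianVF f (a x)) (mfderiv (𝓡 n) (𝓡 n) a x v) = 0
  rw [h, Ω.hamiltonianVF_spec, Ω.hamiltonianVF_spec]
  exact sub_eq_zero.2 (congrArg (c * ·) (congrArg (fun L => L v)
    (mfderiv_comp x ((hf (a x)).mdifferentiableAt (by simp)) hA)))

/-- A conformally symplectic map rescales Poisson brackets. -/
lemma SymplecticForm.PullbackEq.poisson_comp {Ω : SymplecticForm n S} {a b : S → S}
    {c : ℝ} (h : Ω.PullbackEq a c) (ha : ContMDiff (𝓡 n) (𝓡 n) ∞ a)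
    (hb : ContMDiff (𝓡 n) (𝓡 n) ∞ b) (hab : ∀ x, a (b x) = x)
    (hba : ∀ x, b (a x) = x) {f g : S → ℝ}
    (hf : ContMDiff (𝓡 n) 𝓘(ℝ, ℝ) ∞ f) (hg : ContMDiff (𝓡 n) 𝓘(ℝ, ℝ) ∞ g) (x : S) :
    Ω.poisson (fun y => f (a y)) (fun y => g (a y)) x = c * Ω.poisson f g (a x) := by
  rw [Ω.poisson_eq, Ω.poisson_eq, vfDeriv, vfDeriv]
  have h2 := congrArg (fun L => L (Ω.hamiltonianVF (fun y => f (a y)) x))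
    (mfderiv_comp x ((hg (a x)).mdifferentiableAt (by simp)) ((ha x).mdifferentiableAt (by simp)))
  refine h2.trans ?_
  change mfderiv (𝓡 n) 𝓘(ℝ, ℝ) g (a x) (mfderiv (𝓡 n) (𝓡 n) a x _) = _
  rw [h.mfderiv_hamiltonianVF ha hb hab hba hf, map_smul]
  rfl

end HamiltonianVF

/-! ### Principal bundles: local sections, descent, and reduction in stages -/

section PrincipalBundles

variable {EG HG EM HM EK HK EN HN : Type*}
  [NormedAddCommGroup EG] [NormedSpace ℝ EG] [TopologicalSpace HG]
  [NormedAddCommGroup EM] [NormedSpace ℝ EM] [TopologicalSpace HM]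
  [NormedAddCommGroup EK] [NormedSpace ℝ EK] [TopologicalSpace HK]
  [NormedAddCommGroup EN] [NormedSpace ℝ EN] [TopologicalSpace HN]
  {G M K N : Type*} [Group G]
  [TopologicalSpace G] [ChartedSpace HG G]
  [TopologicalSpace M] [ChartedSpace HM M]
  [TopologicalSpace K] [ChartedSpace HK K]
  [TopologicalSpace N] [ChartedSpace HN N]
  {IG : ModelWithCorners ℝ EG HG} {IM : ModelWithCorners ℝ EM HM}
  {IK : ModelWithCorners ℝ EK HK} {IN : ModelWithCorners ℝ EN HN}
  {a : G → M → M} {p : M → K}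

lemma IsSmoothAction.inv_act (h : IsSmoothAction IG IM a) (g : G) (x : M) :
    a g⁻¹ (a g x) = x := by
  rw [← h.mul_act, inv_mul_cancel, h.one_act]

lemma IsSmoothAction.act_inv (h : IsSmoothAction IG IM a) (g : G) (x : M) :
    a g (a g⁻¹ x) = x := by
  rw [← h.mul_act, mul_inv_cancel, h.one_act]

lemma IsSmoothAction.contMDiff_act (h : IsSmoothAction IG IM a) (g : G) :
    ContMDiff IM IM ∞ (a g) :=
  h.contMDiff.comp (contMDiff_const.prodMk contMDiff_id)

lemma IsPrincipalBundle.proj_act (h : IsPrincipalBundle IG IM IK a p) (g : G) (x : M) :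
    p (a g x) = p x :=
  ((h.fiber_iff x _).2 ⟨g, rfl⟩).symm

/-- Over a neighbourhood of every point of the base of a principal bundle there are a smooth section
`σ` and a smooth equivariant map `τ` to the group with `x = τ(x) • σ(p(x))`. -/
lemma IsPrincipalBundle.exists_section (h : IsPrincipalBundle IG IM IK a p) (k₀ : K) :
    ∃ (U : Set K) (σ : K → M) (τ : M → G), IsOpen U ∧ k₀ ∈ U ∧
      ContMDiffOn IK IM ∞ σ U ∧ (∀ k ∈ U, p (σ k) = k) ∧
      ContMDiffOn IM IG ∞ τ (p ⁻¹' U) ∧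
      ∀ x, p x ∈ U → x = a (τ x) (σ (p x)) ∧ ∀ g, τ (a g x) = g * τ x := by
  obtain ⟨U, e, hU, hk, hs, ht, he, he', hee⟩ := h.locally_trivial k₀
  have hmem : ∀ k ∈ U, ∀ g : G, (k, g) ∈ e.target := fun k hk g => by
    rw [ht]; exact ⟨hk, Set.mem_univ _⟩
  have hσ : ∀ k ∈ U, p (e.symm (k, 1)) = k := fun k hk => by
    rw [← (hee _ (e.map_target (hmem k hk 1))).1, e.right_inv (hmem k hk 1)]
  -- The section is the unit slice of the trivialization, and `τ` is its group coordinate.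
  refine ⟨U, fun k => e.symm (k, 1), fun x => (e x).2, hU, hk, ?_, hσ, ?_, fun x hx => ⟨?_, ?_⟩⟩
  · exact he'.comp (contMDiff_id.prodMk contMDiff_const).contMDiffOn fun k hk => hmem k hk 1
  · rw [← hs]
    exact contMDiff_snd.comp_contMDiffOn he
  · have hxs : x ∈ e.source := by rw [hs]; exact hx
    have hys : e.symm (p x, 1) ∈ e.source := e.map_target (hmem _ hx 1)
    have hzs : a (e x).2 (e.symm (p x, 1)) ∈ e.source := by
      rw [hs, Set.mem_preimage, h.proj_act, hσ _ hx]; exact hx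
    refine e.injOn hxs hzs (Prod.ext ?_ ?_)
    · rw [(hee x hxs).1, (hee _ hzs).1, h.proj_act, hσ _ hx]
    · rw [(hee _ hys).2, e.right_inv (hmem _ hx 1), mul_one]
  · exact (hee x (by rw [hs]; exact hx)).2

/-- A map on the base of a principal bundle is smooth if its lift to the total space is. -/
lemma IsPrincipalBundle.contMDiff_of_comp (h : IsPrincipalBundle IG IM IK a p) {f : K → N}
    (hf : ContMDiff IM IN ∞ (fun x => f (p x))) : ContMDiff IK IN ∞ f := by
  intro k
  obtain ⟨U, σ, -, hU, hk, hσ, hpσ, -⟩ := h.exists_section k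
  have h1 : ContMDiffOn IK IN ∞ (fun k => f (p (σ k))) U := hf.comp_contMDiffOn hσ
  exact (h1.congr fun k hk => by rw [hpσ k hk]).contMDiffAt (hU.mem_nhds hk)

/-- Invariant maps descend to the base of a principal bundle. -/
lemma IsPrincipalBundle.exists_descent {α : Type*} (h : IsPrincipalBundle IG IM IK a p) {F : M → α}
    (hF : ∀ g x, F (a g x) = F x) : ∃ f : K → α, ∀ x, f (p x) = F x := by
  refine ⟨fun k => F (h.surjective k).choose, fun x => ?_⟩
  obtain ⟨g, hg⟩ := (h.fiber_iff _ _).1 (h.surjective (p x)).choose_spec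
  conv_rhs => rw [hg, hF]

variable {EL HL EP HP : Type*}
  [NormedAddCommGroup EL] [NormedSpace ℝ EL] [TopologicalSpace HL]
  [NormedAddCommGroup EP] [NormedSpace ℝ EP] [TopologicalSpace HP]
  {L P : Type*} [Group L]
  [TopologicalSpace L] [ChartedSpace HL L]
  [TopologicalSpace P] [ChartedSpace HP P]
  {IL : ModelWithCorners ℝ EL HL} {IP : ModelWithCorners ℝ EP HP}
  {φ : L → M → M} {φP : L → P → P} {q : M → P}

/-- An action on the total space of a principal bundle that commutes with the structure group
descends to a smooth action on the base. -/
lemma IsPrincipalBundle.isSmoothAction_base (hq : IsPrincipalBundle IG IM IP a q)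
    (hφ : IsSmoothAction IL IM φ) (hφP : ∀ s x, φP s (q x) = q (φ s x)) :
    IsSmoothAction IL IP φP where
  one_act y := by
    obtain ⟨x, rfl⟩ := hq.surjective y
    rw [hφP, hφ.one_act]
  mul_act s t y := by
    obtain ⟨x, rfl⟩ := hq.surjective y
    simp only [hφP, hφ.mul_act]
  contMDiff := by
    rintro ⟨s, y⟩
    obtain ⟨U, σ, -, hU, hy, hσ, hpσ, -⟩ := hq.exists_section y
    -- Locally the reduced action is `(s, y) ↦ q(φ_s(σ y))`.
    have h1 : ContMDiffOn (IL.prod IP) IP ∞ (fun z : L × P => q (φ z.1 (σ z.2)))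
        (Set.univ ×ˢ U) :=
      (hq.contMDiff.comp hφ.contMDiff).comp_contMDiffOn
        (contMDiff_fst.contMDiffOn.prodMk (hσ.comp contMDiff_snd.contMDiffOn fun z hz => hz.2))
    refine (h1.congr fun z hz => ?_).contMDiffAt
      ((isOpen_univ.prod hU).mem_nhds ⟨Set.mem_univ _, hy⟩)
    rw [← hφP, hpσ _ hz.2]

/-- If the joint action of `L × G` is principal, so is the action of `L` on the orbit space
of `G`. -/
lemma IsPrincipalBundle.reduction {pj : M → K} (hq : IsPrincipalBundle IG IM IP a q)
    (hj : IsPrincipalBundle (IL.prod IG) IM IK (fun (z : L × G) x => φ z.1 (a z.2 x)) pj)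
    (hφ : IsSmoothAction IL IM φ) (hφP : ∀ s x, φP s (q x) = q (φ s x)) :
    ∃ p : P → K, IsPrincipalBundle IL IP IK φP p := by
  have hpa : ∀ b x, pj (a b x) = pj x := fun b x => by
    have := hj.proj_act (1, b) x
    simpa only [hφ.one_act] using this
  have hpφ : ∀ s x, pj (φ s x) = pj x := fun s x => by
    have := hj.proj_act (s, 1) x
    simpa only [hq.isSmoothAction.one_act] using this
  obtain ⟨p, hp⟩ := hq.exists_descent hpa
  have hps : ContMDiff IP IK ∞ p := hq.contMDiff_of_comp (by simpa only [hp] using hj.contMDiff)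
  refine ⟨p, hq.isSmoothAction_base hφ hφP, hps, fun k => ?_, fun y y' => ?_, fun k => ?_⟩
  · obtain ⟨x, rfl⟩ := hj.surjective k
    exact ⟨q x, hp x⟩
  · obtain ⟨x, rfl⟩ := hq.surjective y
    obtain ⟨x', rfl⟩ := hq.surjective y'
    rw [hp, hp, hj.fiber_iff]
    constructor
    · rintro ⟨⟨s, b⟩, rfl⟩
      exact ⟨s, by rw [← hφP, hq.proj_act]⟩
    · rintro ⟨s, hs⟩
      rw [hφP] at hs
      refine (hj.fiber_iff _ _).1 ?_
      rw [← hp x', hs, hp, hpφ]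
  · obtain ⟨U, e, hU, hk, hs, ht, he, he', hee⟩ := hj.locally_trivial k
    have hmem : ∀ k ∈ U, ∀ g : L × G, (k, g) ∈ e.target := fun k hk g => by
      rw [ht]; exact ⟨hk, Set.mem_univ _⟩
    have hsrc : ∀ x, pj x ∈ U → x ∈ e.source := fun x hx => by rw [hs]; exact hx
    have hea : ∀ b x, pj x ∈ U → (e (a b x)).2 = (1, b) * (e x).2 := fun b x hx => by
      have := (hee x (hsrc x hx)).2 (1, b)
      simpa only [hφ.one_act] using this
    have heφ : ∀ s x, pj x ∈ U → (e (φ s x)).2 = (s, 1) * (e x).2 := fun s x hx => by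
      have := (hee x (hsrc x hx)).2 (s, 1)
      simpa only [hq.isSmoothAction.one_act] using this
    classical
    -- The `L`-coordinate of the joint trivialization is invariant under `G`, so it descends to `P`.
    -- The value `1` off `U` only serves to make the function globally invariant.
    obtain ⟨ℓ, hℓ⟩ := hq.exists_descent
      (F := fun x => if pj x ∈ U then (e x).2.1 else 1) (fun b x => by
        simp only [hpa]
        split_ifs with hx
        · rw [hea b x hx]; simp
        · rfl)
    replace hℓ : ∀ x, pj x ∈ U → ℓ (q x) = (e x).2.1 := fun x hx => by rw [hℓ, if_pos hx]
    have hUo : IsOpen (p ⁻¹' U) := hU.preimage hps.continuous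
    have hℓs : ContMDiffOn IP IL ∞ ℓ (p ⁻¹' U) := by
      intro y hy
      obtain ⟨V, σ, -, hV, hyV, hσ, hpσ, -⟩ := hq.exists_section y
      have h1 : ContMDiffOn IP IL ∞ (fun y => (e (σ y)).2.1) (V ∩ p ⁻¹' U) :=
        (contMDiff_fst.comp contMDiff_snd).comp_contMDiffOn
          (he.comp (hσ.mono Set.inter_subset_left) fun z hz => hsrc _ (by
            rw [← hp, hpσ z hz.1]; exact hz.2))
      refine ((h1.congr fun z hz => ?_).contMDiffAt
        ((hV.inter hUo).mem_nhds ⟨hyV, hy⟩)).contMDiffWithinAt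
      rw [← hℓ, hpσ z hz.1]
      rw [← hp, hpσ z hz.1]; exact hz.2
    have hi : ContMDiffOn (IK.prod IL) IP ∞ (fun z : K × L => q (e.symm (z.1, (z.2, 1))))
        (U ×ˢ Set.univ) :=
      hq.contMDiff.comp_contMDiffOn (he'.comp
        (contMDiff_fst.prodMk (contMDiff_snd.prodMk contMDiff_const)).contMDiffOn
        fun z hz => hmem _ hz.1 _)
    have hsymm : ∀ z : K × L, z.1 ∈ U → pj (e.symm (z.1, (z.2, 1))) = z.1 := fun z hz => by
      rw [← (hee _ (e.map_target (hmem _ hz _))).1, e.right_inv (hmem _ hz _)]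
    refine ⟨U,
      { toFun := fun y => (p y, ℓ y)
        invFun := fun z => q (e.symm (z.1, (z.2, 1)))
        source := p ⁻¹' U
        target := U ×ˢ Set.univ
        map_source' := fun y hy => ⟨hy, Set.mem_univ _⟩
        map_target' := fun z hz => by
          rw [Set.mem_preimage, hp, hsymm z hz.1]; exact hz.1
        left_inv' := fun y hy => by
          obtain ⟨x, rfl⟩ := hq.surjective y
          rw [Set.mem_preimage, hp] at hy
          rw [hp, hℓ x hy]
          -- Moving `x` along its `G`-orbit makes its `G`-coordinate `1` and leaves `q x` unchanged,
          -- which is the form of point used by the inverse map.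
          have h1 : e (a (e x).2.2⁻¹ x) = (pj x, ((e x).2.1, 1)) := by
            refine Prod.ext ?_ ?_
            · rw [(hee _ (hsrc _ (by rwa [hpa]))).1, hpa]
            · rw [hea _ _ hy]; ext <;> simp
          simp only
          rw [← h1, e.left_inv (hsrc _ (by rwa [hpa])), hq.proj_act]
        right_inv' := fun z hz => by
          have h1 := hsymm z hz.1
          refine Prod.ext ?_ ?_
          · simp only [hp, h1]
          · simp only
            rw [hℓ _ (by rw [h1]; exact hz.1), e.right_inv (hmem _ hz.1 _)]
        open_source := hUo
        open_target := hU.prod isOpen_univ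
        continuousOn_toFun := hps.continuous.continuousOn.prodMk hℓs.continuousOn
        continuousOn_invFun := hi.continuousOn }, hU, hk, rfl, rfl,
      hps.contMDiffOn.prodMk hℓs, hi, fun y hy => ⟨rfl, fun s => ?_⟩⟩
    obtain ⟨x, rfl⟩ := hq.surjective y
    change p (q x) ∈ U at hy
    rw [hp] at hy
    change ℓ (φP s (q x)) = s * ℓ (q x)
    rw [hφP, hℓ _ (by rwa [hpφ]), hℓ _ hy, heφ s x hy]
    simp

end PrincipalBundles

/-! ### Derivation rules and the chain rule along a vector field -/

section PoissonAlgebra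

variable {n : ℕ} {S : Type*} [TopologicalSpace S] [ChartedSpace (EuclideanSpace ℝ (Fin n)) S]

lemma vfDeriv_add (X : ∀ x : S, TangentSpace (𝓡 n) x) {f g : S → ℝ}
    (hf : ContMDiff (𝓡 n) 𝓘(ℝ, ℝ) ∞ f) (hg : ContMDiff (𝓡 n) 𝓘(ℝ, ℝ) ∞ g) (x : S) :
    vfDeriv X (fun y => f y + g y) x = vfDeriv X f x + vfDeriv X g x :=
  congrArg (fun L => L (X x))
    (mfderiv_add ((hf x).mdifferentiableAt (by simp)) ((hg x).mdifferentiableAt (by simp)))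

lemma vfDeriv_mul (X : ∀ x : S, TangentSpace (𝓡 n) x) {f g : S → ℝ}
    (hf : ContMDiff (𝓡 n) 𝓘(ℝ, ℝ) ∞ f) (hg : ContMDiff (𝓡 n) 𝓘(ℝ, ℝ) ∞ g) (x : S) :
    vfDeriv X (fun y => f y * g y) x = f x * vfDeriv X g x + vfDeriv X f x * g x := by
  have h := (((hf x).mdifferentiableAt (by simp)).hasMFDerivAt.mul
    ((hg x).mdifferentiableAt (by simp)).hasMFDerivAt).mfderiv
  refine (congrArg (fun L => L (X x)) h).trans ?_
  change f x * vfDeriv X g x + g x * vfDeriv X f x = _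
  ring

lemma vfDeriv_const_mul (X : ∀ x : S, TangentSpace (𝓡 n) x) (c : ℝ) {f : S → ℝ}
    (hf : ContMDiff (𝓡 n) 𝓘(ℝ, ℝ) ∞ f) (x : S) :
    vfDeriv X (fun y => c * f y) x = c * vfDeriv X f x :=
  congrArg (fun L => L (X x)) (const_smul_mfderiv ((hf x).mdifferentiableAt (by simp)) c)

lemma vfDeriv_comp {k : ℕ} {K : Type*} [TopologicalSpace K]
    [ChartedSpace (EuclideanSpace ℝ (Fin k)) K] (X : ∀ x : S, TangentSpace (𝓡 n) x) {f : K → ℝ}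
    {p : S → K} (hf : ContMDiff (𝓡 k) 𝓘(ℝ, ℝ) ∞ f) (hp : ContMDiff (𝓡 n) (𝓡 k) ∞ p) (x : S) :
    vfDeriv X (fun y => f (p y)) x =
      mfderiv (𝓡 k) 𝓘(ℝ, ℝ) f (p x) (mfderiv (𝓡 n) (𝓡 k) p x (X x)) :=
  congrArg (fun L => L (X x))
    (mfderiv_comp x ((hf _).mdifferentiableAt (by simp)) ((hp x).mdifferentiableAt (by simp)))

end PoissonAlgebra

/-! ### The reduced Poisson bracket -/

section Reduction

variable {n m g : ℕ} {S P G : Type*}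
  [TopologicalSpace S] [ChartedSpace (EuclideanSpace ℝ (Fin n)) S] [IsManifold (𝓡 n) ∞ S]
  [TopologicalSpace P] [ChartedSpace (EuclideanSpace ℝ (Fin m)) P]
  [Group G] [TopologicalSpace G] [ChartedSpace (EuclideanSpace ℝ (Fin g)) G]
  {Ω : SymplecticForm n S} {Φ : G → S → S} {q : S → P}

/-- The Poisson bracket of a symplectic form descends to the orbit space of a principal symplectic
action. -/
lemma exists_reduced_poissonBracket
    (hq : IsPrincipalBundle (𝓡 g) (𝓡 n) (𝓡 m) Φ q) (hΦ : ∀ b, Ω.PullbackEq (Φ b) 1) :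
    ∃ B : PoissonBracket m P, ∀ (f₁ f₂ : C^∞⟮𝓡 m, P; ℝ⟯) (x : S),
      B.bracket f₁ f₂ (q x) = Ω.poisson (fun y => f₁ (q y)) (fun y => f₂ (q y)) x := by
  have hs : ∀ f : C^∞⟮𝓡 m, P; ℝ⟯, ContMDiff (𝓡 n) 𝓘(ℝ, ℝ) ∞ (fun y => f (q y)) :=
    fun f => f.contMDiff.comp hq.contMDiff
  have hex : ∀ f₁ f₂ : C^∞⟮𝓡 m, P; ℝ⟯, ∃ F : C^∞⟮𝓡 m, P; ℝ⟯, ∀ x,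
      F (q x) = Ω.poisson (fun y => f₁ (q y)) (fun y => f₂ (q y)) x := by
    intro f₁ f₂
    obtain ⟨F, hF⟩ := hq.exists_descent
      (F := Ω.poisson (fun y => f₁ (q y)) (fun y => f₂ (q y))) (fun b x => by
        have := (hΦ b).poisson_comp (hq.isSmoothAction.contMDiff_act b)
          (hq.isSmoothAction.contMDiff_act b⁻¹) (hq.isSmoothAction.act_inv b)
          (hq.isSmoothAction.inv_act b) (hs f₁) (hs f₂) x
        simp only [hq.proj_act, one_mul] at this
        exact this.symm)
    refine ⟨⟨F, hq.contMDiff_of_comp ?_⟩, hF⟩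
    simpa only [hF] using Ω.contMDiff_poisson (hs f₁) (hs f₂)
  choose br hbr using hex
  have hext : ∀ f g : C^∞⟮𝓡 m, P; ℝ⟯, (∀ x, f (q x) = g (q x)) → f = g := by
    intro f g h
    ext y
    obtain ⟨x, rfl⟩ := hq.surjective y
    exact h x
  -- With antisymmetry, linearity and the Leibniz rule are needed in the second slot only, where
  -- `{f, ·}` is the derivative along `X_f`.
  have hanti : ∀ f₁ f₂, br f₁ f₂ = -br f₂ f₁ := fun f₁ f₂ => hext _ _ fun x => by
    rw [hbr, Ω.poisson_antisymm, ← hbr]; rfl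
  have hadd : ∀ f f₁ f₂, br f (f₁ + f₂) = br f f₁ + br f f₂ := fun f f₁ f₂ => hext _ _ fun x => by
    rw [ContMDiffMap.coe_add, Pi.add_apply, hbr, hbr, hbr]
    simp only [Ω.poisson_eq]
    exact vfDeriv_add _ (hs f₁) (hs f₂) x
  have hsmul : ∀ (c : ℝ) f f₁, br f (c • f₁) = c • br f f₁ := fun c f f₁ => hext _ _ fun x => by
    rw [ContMDiffMap.coe_smul, Pi.smul_apply, hbr, hbr]
    simp only [Ω.poisson_eq]
    exact vfDeriv_const_mul _ c (hs f₁) x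
  have hmul : ∀ f f₁ f₂, br f (f₁ * f₂) = f₁ * br f f₂ + br f f₁ * f₂ :=
    fun f f₁ f₂ => hext _ _ fun x => by
      rw [ContMDiffMap.coe_add, Pi.add_apply, ContMDiffMap.coe_mul, ContMDiffMap.coe_mul,
        Pi.mul_apply, Pi.mul_apply, hbr, hbr, hbr]
      simp only [Ω.poisson_eq]
      exact vfDeriv_mul _ (hs f₁) (hs f₂) x
  refine ⟨⟨LinearMap.mk₂ ℝ br (fun f₁ f₂ f => ?_) (fun c f₁ f => ?_) hadd hsmul, fun f => ?_,
    fun f₁ f₂ f₃ => hext _ _ fun x => ?_, fun f f₁ f₂ => ?_⟩, hbr⟩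
  · rw [hanti, hadd, hanti f, hanti f]; abel
  · rw [hanti, hsmul, hanti f, smul_neg, neg_neg]
  · simp only [LinearMap.mk₂_apply]
    exact hext _ _ fun x => (hbr f f x).trans (Ω.alternating x _)
  · have := Ω.poisson_jacobi (hs f₁) (hs f₂) (hs f₃) x
    simp only [LinearMap.mk₂_apply, ContMDiffMap.coe_add, Pi.add_apply, hbr]
    exact this
  · simp only [LinearMap.mk₂_apply]
    rw [hanti, hmul, hanti f₂, hanti f₂]
    ring

end Reduction

/-! ### Sections of `L^*` as homogeneous functions, and the Kirillov bracket -/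

lemma contMDiff_scal (Λ : OpenSubgroup ℝˣ) :
    ContMDiff 𝓘(ℝ, ℝ) 𝓘(ℝ, ℝ) ∞ (scal : Λ → ℝ) :=
  (Units.contMDiff_val (R := ℝ)).comp
    (contMDiff_subtype_val (U := (Λ : TopologicalSpace.Opens ℝˣ)))

section DualSections

variable {m d : ℕ} {M K : Type*} {Λ : OpenSubgroup ℝˣ}
  [TopologicalSpace M] [ChartedSpace (EuclideanSpace ℝ (Fin m)) M]
  [TopologicalSpace K] [ChartedSpace (EuclideanSpace ℝ (Fin d)) K]
  {φ : Λ → M → M} {p : M → K}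

/-- A section of the dual line bundle as a function on the total space of the line bundle. -/
def dualEval {hp : IsPrincipalBundle 𝓘(ℝ, ℝ) (𝓡 m) (𝓡 d) φ p}
    (h : ∀ k, Module.Dual ℝ (LineFiber hp k)) (l : LineTotal hp) : ℝ :=
  h (LineTotal.proj hp l) ⟨l, rfl⟩

lemma dualEval_mk {hp : IsPrincipalBundle 𝓘(ℝ, ℝ) (𝓡 m) (𝓡 d) φ p}
    (h : ∀ k, Module.Dual ℝ (LineFiber hp k)) (x : M) (t : ℝ) :
    dualEval h (LineTotal.mk hp x t) = h (p x) (LineFiber.mk hp x t) := rfl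

lemma dualEval_mk_eq_mul {hp : IsPrincipalBundle 𝓘(ℝ, ℝ) (𝓡 m) (𝓡 d) φ p}
    (h : ∀ k, Module.Dual ℝ (LineFiber hp k)) (x : M) (t : ℝ) :
    dualEval h (LineTotal.mk hp x t) = t * dualEval h (LineTotal.mk hp x 1) := by
  rw [dualEval_mk, dualEval_mk, ← smul_eq_mul, ← map_smul, ← LineFiber.mk_smul, mul_one]

/-- This is `[φ_s x, 1] = [x, s]` and linearity in the fibre. Evaluating on the total space of `L`
avoids transport between the fibres over the equal points `p (φ_s x)` and `p x`. -/
lemma dualEval_act {hp : IsPrincipalBundle 𝓘(ℝ, ℝ) (𝓡 m) (𝓡 d) φ p}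
    (h : ∀ k, Module.Dual ℝ (LineFiber hp k)) (s : Λ) (x : M) :
    dualEval h (LineTotal.mk hp (φ s x) 1) = scal s * dualEval h (LineTotal.mk hp x 1) := by
  rw [← dualEval_mk_eq_mul]
  congr 1
  exact ((LineTotal.mk_eq_iff hp).2 ⟨s, rfl, (div_self (scal_ne_zero s)).symm⟩).symm

/-- The homogeneous function `y ↦ h(p y)[y, 1]` of a section `h` of the dual line bundle. -/
def homogeneousOf (hp : IsPrincipalBundle 𝓘(ℝ, ℝ) (𝓡 m) (𝓡 d) φ p) (h : dualSections hp) :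
    C^∞⟮𝓡 m, M; ℝ⟯ :=
  ⟨fun y => dualEval h.1 (LineTotal.mk hp y 1), fun y => by
    obtain ⟨U, σ, τ, hU, hy, hσ, hpσ, hτ, hστ⟩ := hp.exists_section (p y)
    -- Smoothness of the section is known only on local frames `[σ k, 1]`; homogeneity along `y =
    -- φ_{τ(y)} σ(p y)` extends it to `p ⁻¹' U`.
    have h1 : ContMDiffOn (𝓡 m) 𝓘(ℝ, ℝ) ∞
        (fun y => scal (τ y) * dualEval h.1 (LineTotal.mk hp (σ (p y)) 1)) (p ⁻¹' U) :=
      ((contMDiff_scal Λ).comp_contMDiffOn hτ).mul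
        ((h.2 U σ hU hσ hpσ).comp hp.contMDiff.contMDiffOn fun _ hz => hz)
    refine (h1.congr fun z hz => ?_).contMDiffAt
      ((hU.preimage hp.contMDiff.continuous).mem_nhds hy)
    rw [← dualEval_act, ← (hστ z hz).1]⟩

lemma homogeneousOf_apply (hp : IsPrincipalBundle 𝓘(ℝ, ℝ) (𝓡 m) (𝓡 d) φ p) (h : dualSections hp)
    (y : M) : homogeneousOf hp h y = h.1 (p y) (LineFiber.mk hp y 1) := rfl

lemma homogeneousOf_add (hp : IsPrincipalBundle 𝓘(ℝ, ℝ) (𝓡 m) (𝓡 d) φ p)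
    (h h' : dualSections hp) :
    homogeneousOf hp (h + h') = homogeneousOf hp h + homogeneousOf hp h' := by
  ext y
  rfl

lemma homogeneousOf_smul (hp : IsPrincipalBundle 𝓘(ℝ, ℝ) (𝓡 m) (𝓡 d) φ p) (c : ℝ)
    (h : dualSections hp) : homogeneousOf hp (c • h) = c • homogeneousOf hp h := by
  ext y
  rfl

lemma isHomogeneous_homogeneousOf (hp : IsPrincipalBundle 𝓘(ℝ, ℝ) (𝓡 m) (𝓡 d) φ p)
    (h : dualSections hp) : IsHomogeneous φ (homogeneousOf hp h) :=
  dualEval_act h.1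

/-- Elements of the dual of the fibre over `p y` are determined by their value at `[y, 1]`. -/
lemma LineFiber.dual_ext (hp : IsPrincipalBundle 𝓘(ℝ, ℝ) (𝓡 m) (𝓡 d) φ p) (y : M)
    {α β : Module.Dual ℝ (LineFiber hp (p y))}
    (h : α (LineFiber.mk hp y 1) = β (LineFiber.mk hp y 1)) : α = β := by
  ext l
  obtain ⟨t, rfl⟩ := (LineFiber.mkAt_bijective hp (x := y) rfl).surjective l
  change α (LineFiber.mk hp y t) = β (LineFiber.mk hp y t)
  rw [← mul_one t, LineFiber.mk_smul, map_smul, map_smul, h]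

/-- Together with `homogeneousOf_sectionOf` this identifies sections of `L^*` with homogeneous
functions, so identities between sections can be checked on functions. -/
lemma homogeneousOf_injective (hp : IsPrincipalBundle 𝓘(ℝ, ℝ) (𝓡 m) (𝓡 d) φ p) :
    Function.Injective (homogeneousOf hp) := by
  intro h h' hh
  refine Subtype.ext (funext fun k => ?_)
  obtain ⟨y, rfl⟩ := hp.surjective k
  exact LineFiber.dual_ext hp y (DFunLike.congr_fun hh y)

lemma homogeneousOf_sectionOf (hp : IsPrincipalBundle 𝓘(ℝ, ℝ) (𝓡 m) (𝓡 d) φ p)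
    (H : C^∞⟮𝓡 m, M; ℝ⟯) (hH : IsHomogeneous φ H) :
    homogeneousOf hp (sectionOf hp H hH) = H := by
  ext y
  rw [homogeneousOf_apply, sectionOf_apply, one_mul]

/-- The pullback of a smooth function to the total space of a principal bundle. -/
def pullbackFun (hp : IsPrincipalBundle 𝓘(ℝ, ℝ) (𝓡 m) (𝓡 d) φ p) (f : C^∞⟮𝓡 d, K; ℝ⟯) :
    C^∞⟮𝓡 m, M; ℝ⟯ :=
  ⟨fun y => f (p y), f.contMDiff.comp hp.contMDiff⟩

lemma homogeneousOf_funSmul (hp : IsPrincipalBundle 𝓘(ℝ, ℝ) (𝓡 m) (𝓡 d) φ p)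
    (f : C^∞⟮𝓡 d, K; ℝ⟯) (h : dualSections hp) :
    homogeneousOf hp (funSmul hp f h) = pullbackFun hp f * homogeneousOf hp h := rfl

lemma IsHomogeneous.neg {H : C^∞⟮𝓡 m, M; ℝ⟯} (hH : IsHomogeneous φ H) :
    IsHomogeneous φ (-H : C^∞⟮𝓡 m, M; ℝ⟯) := fun s x => by
  rw [ContMDiffMap.coe_neg, Pi.neg_apply, Pi.neg_apply, hH s x, mul_neg]

/-- The bracket of sections of the dual line bundle defined by a homogeneous Poisson bracket. -/
def dualBracket (hp : IsPrincipalBundle 𝓘(ℝ, ℝ) (𝓡 m) (𝓡 d) φ p) (B : PoissonBracket m M)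
    (hB : ∀ F F' : C^∞⟮𝓡 m, M; ℝ⟯, IsHomogeneous φ F → IsHomogeneous φ F' →
      IsHomogeneous φ (B.bracket F F')) (h h' : dualSections hp) : dualSections hp :=
  sectionOf hp (-B.bracket (homogeneousOf hp h) (homogeneousOf hp h'))
    (hB _ _ (isHomogeneous_homogeneousOf hp h) (isHomogeneous_homogeneousOf hp h')).neg

lemma homogeneousOf_dualBracket (hp : IsPrincipalBundle 𝓘(ℝ, ℝ) (𝓡 m) (𝓡 d) φ p)
    (B : PoissonBracket m M)
    (hB : ∀ F F' : C^∞⟮𝓡 m, M; ℝ⟯, IsHomogeneous φ F → IsHomogeneous φ F' →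
      IsHomogeneous φ (B.bracket F F')) (h h' : dualSections hp) :
    homogeneousOf hp (dualBracket hp B hB h h') =
      -B.bracket (homogeneousOf hp h) (homogeneousOf hp h') :=
  homogeneousOf_sectionOf hp _ _

lemma PoissonBracket.antisymm (B : PoissonBracket m M) (f g : C^∞⟮𝓡 m, M; ℝ⟯) :
    B.bracket f g = -B.bracket g f := by
  have h := B.self_eq_zero (f + g)
  rw [map_add, map_add, LinearMap.add_apply, LinearMap.add_apply, B.self_eq_zero,
    B.self_eq_zero, zero_add, add_zero] at h
  exact eq_neg_of_add_eq_zero_right h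

/-- A vector field on the base that represents the Hamiltonian operator `{F, ·}` on basic functions,
with `F` the homogeneous function of `h₂`, is a symbol of `[·, h₂]`. -/
lemma isSymbol_dualBracket (hp : IsPrincipalBundle 𝓘(ℝ, ℝ) (𝓡 m) (𝓡 d) φ p)
    (B : PoissonBracket m M)
    (hB : ∀ F F' : C^∞⟮𝓡 m, M; ℝ⟯, IsHomogeneous φ F → IsHomogeneous φ F' →
      IsHomogeneous φ (B.bracket F F')) (h₂ : dualSections hp)
    {X : ∀ k : K, TangentSpace (𝓡 d) k}
    (hX : ∀ (f : C^∞⟮𝓡 d, K; ℝ⟯) y,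
      vfDeriv X f (p y) = B.bracket (homogeneousOf hp h₂) (pullbackFun hp f) y) :
    IsSymbol hp (fun h₁ => dualBracket hp B hB h₁ h₂) X := by
  intro f h₁ k
  obtain ⟨y, rfl⟩ := hp.surjective k
  refine LineFiber.dual_ext hp y ?_
  rw [LinearMap.add_apply, LinearMap.smul_apply, LinearMap.smul_apply]
  simp only [← homogeneousOf_apply, homogeneousOf_dualBracket, homogeneousOf_funSmul,
    B.leibniz, hX, smul_eq_mul]
  -- The minus sign in the definition of the bracket turns `-{f, F₂}` into `{F₂, f}`, so the symbol
  -- is the projection of `X_{F₂}` and not its negative.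
  rw [B.antisymm (homogeneousOf hp h₂) (pullbackFun hp f)]
  change -(f (p y) * _ + _ * _) = f (p y) * -_ + -_ * _
  ring

/-- The Kirillov bracket defined by a homogeneous Poisson bracket. -/
def kirillovOf [IsManifold (𝓡 d) ∞ K] (hp : IsPrincipalBundle 𝓘(ℝ, ℝ) (𝓡 m) (𝓡 d) φ p)
    (B : PoissonBracket m M)
    (hB : ∀ F F' : C^∞⟮𝓡 m, M; ℝ⟯, IsHomogeneous φ F → IsHomogeneous φ F' →
      IsHomogeneous φ (B.bracket F F'))
    (hX : ∀ F : C^∞⟮𝓡 m, M; ℝ⟯, IsHomogeneous φ F → ∃ X : ∀ k : K, TangentSpace (𝓡 d) k,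
      IsSmoothVectorField X ∧ ∀ (f : C^∞⟮𝓡 d, K; ℝ⟯) y,
        vfDeriv X f (p y) = B.bracket F (pullbackFun hp f) y) : KirillovBracket hp where
  bracket := LinearMap.mk₂ ℝ (dualBracket hp B hB)
    (fun h h' h'' => homogeneousOf_injective hp (by
      rw [homogeneousOf_add]
      simp only [homogeneousOf_dualBracket, homogeneousOf_add]
      rw [map_add, LinearMap.add_apply, neg_add]))
    (fun c h h' => homogeneousOf_injective hp (by
      rw [homogeneousOf_smul]
      simp only [homogeneousOf_dualBracket, homogeneousOf_smul]
      rw [map_smul, LinearMap.smul_apply, smul_neg]))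
    (fun h h' h'' => homogeneousOf_injective hp (by
      rw [homogeneousOf_add]
      simp only [homogeneousOf_dualBracket, homogeneousOf_add]
      rw [map_add, neg_add]))
    (fun c h h' => homogeneousOf_injective hp (by
      rw [homogeneousOf_smul]
      simp only [homogeneousOf_dualBracket, homogeneousOf_smul]
      rw [map_smul, smul_neg]))
  self_eq_zero h := homogeneousOf_injective hp (by
    change homogeneousOf hp (dualBracket hp B hB h h) = 0
    rw [homogeneousOf_dualBracket, B.self_eq_zero, neg_zero])
  jacobi h₁ h₂ h₃ := homogeneousOf_injective hp (by
    change homogeneousOf hp (dualBracket hp B hB h₁ (dualBracket hp B hB h₂ h₃))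
      + homogeneousOf hp (dualBracket hp B hB h₂ (dualBracket hp B hB h₃ h₁))
      + homogeneousOf hp (dualBracket hp B hB h₃ (dualBracket hp B hB h₁ h₂)) = 0
    -- Each double bracket carries two minus signs, which cancel.
    simp only [homogeneousOf_dualBracket, map_neg, neg_neg]
    exact B.jacobi _ _ _)
  derivation h₂ := by
    obtain ⟨X, hXs, hX⟩ := hX _ (isHomogeneous_homogeneousOf hp h₂)
    exact ⟨X, hXs, isSymbol_dualBracket hp B hB h₂ hX⟩

/-! ### Uniqueness of the symbol -/

section Uniqueness

variable [IsManifold (𝓡 d) ∞ K] [T2Space K]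

/-- The dual line bundle has sections that do not vanish at a given point. -/
lemma exists_dualSection_ne_zero (hp : IsPrincipalBundle 𝓘(ℝ, ℝ) (𝓡 m) (𝓡 d) φ p) (k : K) :
    ∃ h : dualSections hp, h.1 k ≠ 0 := by
  obtain ⟨U, σ, τ, hU, hk, -, -, hτ, hστ⟩ := hp.exists_section k
  obtain ⟨ρ, hρ⟩ : ∃ ρ : SmoothBumpFunction (𝓡 d) k, tsupport ρ ⊆ U := by
    obtain ⟨ρ, -, hρ⟩ := (SmoothBumpFunction.nhds_basis_tsupport (I := 𝓡 d) k).mem_iff.1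
      (hU.mem_nhds hk)
    exact ⟨ρ, hρ⟩
  have hρ0 : ∀ k ∉ U, ρ k = 0 := fun k hk => image_eq_zero_of_notMem_tsupport fun h => hk (hρ h)
  -- Over `U` the function `scal ∘ τ` is homogeneous and nowhere zero; the bump function, constant
  -- along fibres, extends it by zero without spoiling homogeneity.
  have hs : ContMDiff (𝓡 m) 𝓘(ℝ, ℝ) ∞ (fun y => ρ (p y) * scal (τ y)) := by
    intro y
    by_cases hy : p y ∈ U
    · exact ((ρ.contMDiff.comp hp.contMDiff).contMDiffOn.mul
        ((contMDiff_scal Λ).comp_contMDiffOn hτ)).contMDiffAt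
        ((hU.preimage hp.contMDiff.continuous).mem_nhds hy)
    · refine (contMDiffAt_const (c := (0 : ℝ))).congr_of_eventuallyEq ?_
      have ho : IsOpen (p ⁻¹' (tsupport ρ)ᶜ) :=
        (isClosed_tsupport ρ).isOpen_compl.preimage hp.contMDiff.continuous
      filter_upwards [ho.mem_nhds (show p y ∈ (tsupport ρ)ᶜ from fun h => hy (hρ h))] with z hz
      rw [image_eq_zero_of_notMem_tsupport hz, zero_mul]
  have hh : IsHomogeneous φ (fun y => ρ (p y) * scal (τ y)) := fun s y => by
    simp only [hp.proj_act]
    by_cases hy : p y ∈ U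
    · rw [(hστ y hy).2, scal_mul]; ring
    · rw [hρ0 _ hy]; ring
  refine ⟨sectionOf hp ⟨_, hs⟩ hh, fun h0 => ?_⟩
  obtain ⟨y, rfl⟩ := hp.surjective k
  have h1 := sectionOf_apply hp ⟨_, hs⟩ hh y 1
  rw [h0, one_mul, LinearMap.zero_apply] at h1
  have h2 : ρ (p y) * scal (τ y) = 0 := h1.symm
  rw [ρ.eq_one, one_mul] at h2
  exact scal_ne_zero _ h2

/-- Smooth functions separate tangent vectors. -/
lemma tangent_ext {k : K} {v w : TangentSpace (𝓡 d) k}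
    (h : ∀ f : C^∞⟮𝓡 d, K; ℝ⟯, mfderiv (𝓡 d) 𝓘(ℝ, ℝ) f k v = mfderiv (𝓡 d) 𝓘(ℝ, ℝ) f k w) :
    v = w := by
  obtain ⟨ρ⟩ : Nonempty (SmoothBumpFunction (𝓡 d) k) := inferInstance
  have hF : ContMDiff (𝓡 d) 𝓘(ℝ, EuclideanSpace ℝ (Fin d)) ∞
      (fun x => ρ x • extChartAt (𝓡 d) k x) :=
    ρ.contMDiff_smul (contMDiffOn_extChartAt (I := 𝓡 d))
  -- The cut-off chart is globally smooth and has the same differential at `k` as the chart, which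
  -- is injective; its coordinates are the test functions.
  have hFe : (fun x => ρ x • extChartAt (𝓡 d) k x) =ᶠ[𝓝 k] extChartAt (𝓡 d) k := by
    filter_upwards [ρ.eventuallyEq_one] with x hx
    rw [hx]; exact one_smul _ _
  have hinj : Function.Injective
      (mfderiv (𝓡 d) 𝓘(ℝ, EuclideanSpace ℝ (Fin d)) (extChartAt (𝓡 d) k) k) :=
    (isInvertible_mfderiv_extChartAt (I := 𝓡 d) (mem_extChartAt_source (I := 𝓡 d) k)).injective
  apply hinj
  rw [← hFe.mfderiv_eq]
  refine PiLp.ext fun i => ?_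
  have hL : ∀ u : TangentSpace (𝓡 d) k,
      mfderiv (𝓡 d) 𝓘(ℝ, ℝ)
        (fun x => EuclideanSpace.proj (𝕜 := ℝ) i (ρ x • extChartAt (𝓡 d) k x)) k u =
      EuclideanSpace.proj (𝕜 := ℝ) i (mfderiv (𝓡 d) 𝓘(ℝ, EuclideanSpace ℝ (Fin d))
        (fun x => ρ x • extChartAt (𝓡 d) k x) k u : EuclideanSpace ℝ (Fin d)) := by
    intro u
    have := mfderiv_comp k (EuclideanSpace.proj (𝕜 := ℝ) i : EuclideanSpace ℝ (Fin d) →L[ℝ] ℝ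
      ).mdifferentiableAt ((hF k).mdifferentiableAt (by simp))
    rw [ContinuousLinearMap.mfderiv_eq] at this
    exact congrArg (fun L => L u) this
  have h1 := h ⟨_, (EuclideanSpace.proj (𝕜 := ℝ) i : EuclideanSpace ℝ (Fin d) →L[ℝ] ℝ
    ).contMDiff.comp hF⟩
  exact ((hL v).symm.trans h1).trans (hL w)

/-- The symbol of an operator on sections of the dual line bundle is unique. -/
lemma IsSymbol.unique {hp : IsPrincipalBundle 𝓘(ℝ, ℝ) (𝓡 m) (𝓡 d) φ p}
    {D : dualSections hp → dualSections hp} {X Y : ∀ k : K, TangentSpace (𝓡 d) k}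
    (hX : IsSymbol hp D X) (hY : IsSymbol hp D Y) : X = Y := by
  funext k
  obtain ⟨h, hh⟩ := exists_dualSection_ne_zero hp k
  refine tangent_ext fun f => ?_
  -- The two symbol identities differ only in `X(f) h = Y(f) h`, and `h k ≠ 0`.
  have h1 := (hX f h k).symm.trans (hY f h k)
  exact smul_left_injective ℝ hh (add_left_cancel h1)

end Uniqueness

end DualSections

/-! ### Projecting Hamiltonian vector fields to `K` -/

section Projection

variable {n m d g : ℕ} {S P K G : Type*} {Λ : OpenSubgroup ℝˣ}
  [TopologicalSpace S] [ChartedSpace (EuclideanSpace ℝ (Fin n)) S] [IsManifold (𝓡 n) ∞ S]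
  [TopologicalSpace P] [ChartedSpace (EuclideanSpace ℝ (Fin m)) P]
  [TopologicalSpace K] [ChartedSpace (EuclideanSpace ℝ (Fin d)) K]
  [Group G] [TopologicalSpace G] [ChartedSpace (EuclideanSpace ℝ (Fin g)) G]
  {Ω : SymplecticForm n S} {Φ : G → S → S} {q : S → P} {φ : Λ → S → S} {φP : Λ → P → P}
  {p : P → K}

lemma SymplecticForm.hamiltonianVF_const_mul (Ω : SymplecticForm n S) (c : ℝ) {f : S → ℝ}
    (hf : ContMDiff (𝓡 n) 𝓘(ℝ, ℝ) ∞ f) (x : S) :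
    Ω.hamiltonianVF (fun y => c * f y) x = c • Ω.hamiltonianVF f x := by
  rw [← sub_eq_zero]
  refine Ω.nondegenerate x _ fun w => ?_
  rw [map_sub, map_smul, sub_apply, smul_apply, Ω.hamiltonianVF_spec, Ω.hamiltonianVF_spec]
  exact sub_eq_zero.2 (congrArg (fun L => L w)
    (const_smul_mfderiv ((hf x).mdifferentiableAt (by simp)) c))

/-- The projection of the Hamiltonian vector field of `f` along `π` is invariant under a
diffeomorphism over `π` that rescales the form and the function by the same factor. -/
lemma SymplecticForm.PullbackEq.mfderiv_hamiltonianVF_proj {a b : S → S}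
    {c : ℝ} (h : Ω.PullbackEq a c) (hc : c ≠ 0) (ha : ContMDiff (𝓡 n) (𝓡 n) ∞ a)
    (hb : ContMDiff (𝓡 n) (𝓡 n) ∞ b) (hab : ∀ x, a (b x) = x)
    (hba : ∀ x, b (a x) = x) {f : S → ℝ}
    (hf : ContMDiff (𝓡 n) 𝓘(ℝ, ℝ) ∞ f) (hfa : ∀ x, f (a x) = c * f x) {π : S → K}
    (hπ : ContMDiff (𝓡 n) (𝓡 d) ∞ π) (hπa : ∀ x, π (a x) = π x) (x : S) :
    (mfderiv (𝓡 n) (𝓡 d) π (a x) (Ω.hamiltonianVF f (a x)) : EuclideanSpace ℝ (Fin d)) =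
      mfderiv (𝓡 n) (𝓡 d) π x (Ω.hamiltonianVF f x) := by
  have h1 := h.mfderiv_hamiltonianVF ha hb hab hba hf x
  -- Here `f ∘ a = c f` gives `c • Ta(X_f) = c • X_f ∘ a`, and `c ≠ 0` cancels.
  have h2 : Ω.hamiltonianVF f (a x) = mfderiv (𝓡 n) (𝓡 n) a x (Ω.hamiltonianVF f x) := by
    simp only [hfa] at h1
    rw [Ω.hamiltonianVF_const_mul c hf, map_smul] at h1
    exact (smul_right_injective _ hc h1).symm
  rw [h2]
  have h3 := congrArg (fun L => L (Ω.hamiltonianVF f x)) (mfderiv_comp x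
    ((hπ (a x)).mdifferentiableAt (by simp)) ((ha x).mdifferentiableAt (by simp)))
  have h4 : π ∘ a = π := funext hπa
  refine h3.symm.trans ?_
  exact congrArg (fun F : S → K =>
    (mfderiv (𝓡 n) (𝓡 d) F x (Ω.hamiltonianVF f x) : EuclideanSpace ℝ (Fin d))) h4

/-- The Hamiltonian vector field of an invariant homogeneous function is projectable. -/
lemma exists_projected_hamiltonianVF [IsManifold (𝓡 d) ∞ K]
    (hq : IsPrincipalBundle (𝓡 g) (𝓡 n) (𝓡 m) Φ q) (hΦ : ∀ b, Ω.PullbackEq (Φ b) 1)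
    (hφ : IsSmoothAction 𝓘(ℝ, ℝ) (𝓡 n) φ) (hφs : ∀ s, Ω.PullbackEq (φ s) (scal s))
    (hφP : ∀ s x, φP s (q x) = q (φ s x))
    (hp : IsPrincipalBundle 𝓘(ℝ, ℝ) (𝓡 m) (𝓡 d) φP p) {F : C^∞⟮𝓡 m, P; ℝ⟯}
    (hF : IsHomogeneous φP F) :
    ∃ X : ∀ k : K, TangentSpace (𝓡 d) k, IsSmoothVectorField X ∧
      ∀ x : S, mfderiv (𝓡 n) (𝓡 d) (fun y => p (q y)) x (Ω.hamiltonianVF (fun y => F (q y)) x) =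
        X (p (q x)) := by
  have hπ : ContMDiff (𝓡 n) (𝓡 d) ∞ (fun y => p (q y)) := hp.contMDiff.comp hq.contMDiff
  have hFq : ContMDiff (𝓡 n) 𝓘(ℝ, ℝ) ∞ (fun y => F (q y)) := F.contMDiff.comp hq.contMDiff
  have hsurj : Function.Surjective (fun y => p (q y)) := hp.surjective.comp hq.surjective
  -- The values are taken in the model space, so that projected vectors at different points of a
  -- fibre can be compared.
  let V : S → EuclideanSpace ℝ (Fin d) := fun x =>
    mfderiv (𝓡 n) (𝓡 d) (fun y => p (q y)) x (Ω.hamiltonianVF (fun y => F (q y)) x)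
  have hVΦ : ∀ b x, V (Φ b x) = V x := fun b x =>
    (hΦ b).mfderiv_hamiltonianVF_proj one_ne_zero (hq.isSmoothAction.contMDiff_act b)
      (hq.isSmoothAction.contMDiff_act b⁻¹) (hq.isSmoothAction.act_inv b)
      (hq.isSmoothAction.inv_act b) hFq (fun x => by rw [hq.proj_act, one_mul]) hπ
      (fun x => by rw [hq.proj_act]) x
  have hVφ : ∀ s x, V (φ s x) = V x := fun s x =>
    (hφs s).mfderiv_hamiltonianVF_proj (scal_ne_zero s) (hφ.contMDiff_act s)
      (hφ.contMDiff_act s⁻¹) (hφ.act_inv s) (hφ.inv_act s) hFq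
      (fun x => by rw [← hφP, hF]) hπ (fun x => by rw [← hφP, hp.proj_act]) x
  have hV : ∀ x x', p (q x) = p (q x') → V x = V x' := by
    intro x x' h
    -- Points of one fibre of `p ∘ q` are related by `x' = Φ_b(φ_s x)`.
    obtain ⟨s, hs⟩ := (hp.fiber_iff _ _).1 h
    rw [hφP] at hs
    obtain ⟨b, rfl⟩ := (hq.fiber_iff _ _).1 hs.symm
    rw [hVΦ, hVφ]
  let X : ∀ k : K, TangentSpace (𝓡 d) k := fun k => V (hsurj k).choose
  have hX : ∀ x, X (p (q x)) = V x := fun x => hV _ _ (hsurj (p (q x))).choose_spec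
  refine ⟨X, fun k => ?_, fun x => (hX x).symm⟩
  obtain ⟨U, σ, -, hU, hk, hσ, hpσ, -⟩ := hp.exists_section k
  obtain ⟨W, ρ, -, hW, hσk, hρ, hqρ, -⟩ := hq.exists_section (σ k)
  have hσc : ContinuousOn σ U := hσ.continuousOn
  have hO : IsOpen (U ∩ σ ⁻¹' W) := hσc.isOpen_inter_preimage hU hW
  -- The composite `ρ ∘ σ` is a local section of `p ∘ q`, and `X` is locally `T(p ∘ q)` applied to
  -- the Hamiltonian field along it.
  have hs : ContMDiffOn (𝓡 d) (𝓡 n) ∞ (fun k => ρ (σ k)) (U ∩ σ ⁻¹' W) :=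
    hρ.comp (hσ.mono Set.inter_subset_left) fun z hz => hz.2
  have h1 : ContMDiffOn (𝓡 d) (𝓡 d).tangent ∞ (fun k =>
      tangentMap (𝓡 n) (𝓡 d) (fun y => p (q y))
        ⟨ρ (σ k), Ω.hamiltonianVF (fun y => F (q y)) (ρ (σ k))⟩) (U ∩ σ ⁻¹' W) :=
    ((hπ.contMDiff_tangentMap (m := ∞) le_rfl).comp
      (Ω.isSmoothVectorField_hamiltonianVF hFq)).comp_contMDiffOn hs
  refine (h1.congr fun z hz => ?_).contMDiffAt (hO.mem_nhds ⟨hk, hσk⟩)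
  have h2 : p (q (ρ (σ z))) = z := by rw [hqρ _ hz.2, hpσ _ hz.1]
  change (⟨z, X z⟩ : TangentBundle (𝓡 d) K) = ⟨p (q (ρ (σ z))), V (ρ (σ z))⟩
  rw [← hX, h2]

end Projection

end

/-! ### The main theorem -/

theorem mainTheorem3 {n g m : ℕ} {S P : Type u} {G : Type*}
    -- the symplectic Hamiltonian system
    [TopologicalSpace S] [ChartedSpace (EuclideanSpace ℝ (Fin n)) S] [IsManifold (𝓡 n) ∞ S]
    [T2Space S] [SecondCountableTopology S]
    (Ω : SymplecticForm n S) (H : C^∞⟮𝓡 n, S; ℝ⟯)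
    -- the scaling group and the scaling symmetry
    (Λ : OpenSubgroup ℝˣ) (hΛ : (Λ : Subgroup ℝˣ) = ⊤ ∨ (Λ : Subgroup ℝˣ) = Units.posSubgroup ℝ)
    (φ : Λ → S → S) (hφ : IsScalingSymmetry Ω H φ)
    -- the Lie group, the orbit manifold and the symplectic symmetry
    [Group G] [TopologicalSpace G] [ChartedSpace (EuclideanSpace ℝ (Fin g)) G]
    [LieGroup (𝓡 g) ∞ G]
    [TopologicalSpace P] [ChartedSpace (EuclideanSpace ℝ (Fin m)) P] [IsManifold (𝓡 m) ∞ P]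
    [T2Space P] [SecondCountableTopology P]
    (Φ : G → S → S) (q : S → P) (hΦ : IsSymplecticSymmetry Ω H g m Φ q)
    -- compatibility: the actions commute, and together they form a principal action
    (hcomm : ∀ b s x, Φ b (φ s x) = φ s (Φ b x))
    (hjoint : IsPrincipalAction (𝓘(ℝ, ℝ).prod (𝓡 g)) (𝓡 n)
      (fun (z : Λ × G) x => φ z.1 (Φ z.2 x))) :
    -- the reduced Poisson bracket, the reduced Hamiltonian and the reduced action on `P`
    ∃ (B : PoissonBracket m P) (HG : C^∞⟮𝓡 m, P; ℝ⟯) (φP : Λ → P → P),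
      (∀ (f₁ f₂ : C^∞⟮𝓡 m, P; ℝ⟯) (x : S),
        B.bracket f₁ f₂ (q x) = Ω.poisson (fun y => f₁ (q y)) (fun y => f₂ (q y)) x) ∧
      (∀ x, HG (q x) = H x) ∧
      (∀ s x, φP s (q x) = q (φ s x)) ∧
      B.IsScalingSymmetry HG φP ∧
      -- for the orbit manifold `K` of the reduced action and its associated line bundle
      ∀ (d : ℕ) (K : Type u) [TopologicalSpace K] [ChartedSpace (EuclideanSpace ℝ (Fin d)) K]
        [IsManifold (𝓡 d) ∞ K] [T2Space K] [SecondCountableTopology K]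
        (p : P → K) (hp : IsPrincipalBundle 𝓘(ℝ, ℝ) (𝓡 m) (𝓡 d) φP p),
        ∃ (hHG : IsHomogeneous φP HG) (kir : KirillovBracket hp),
          (∀ (H₁ H₂ : C^∞⟮𝓡 m, P; ℝ⟯) (h₁ : IsHomogeneous φP H₁) (h₂ : IsHomogeneous φP H₂),
            ∃ h₁₂ : IsHomogeneous φP (B.bracket H₁ H₂),
              kir.bracket (sectionOf hp H₁ h₁) (sectionOf hp H₂ h₂) =
                -sectionOf hp (B.bracket H₁ H₂) h₁₂) ∧
          ∃ X : ∀ k : K, TangentSpace (𝓡 d) k,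
            IsSmoothVectorField X ∧
            IsSymbol hp (fun h => kir.bracket h (sectionOf hp HG hHG)) X ∧
            (∀ Y : ∀ k : K, TangentSpace (𝓡 d) k,
              IsSymbol hp (fun h => kir.bracket h (sectionOf hp HG hHG)) Y → Y = X) ∧
            ∀ x : S, mfderiv (𝓡 n) (𝓡 d) (fun y => p (q y)) x (Ω.hamiltonianVF H x) = X (p (q x)) := by
  have hq := hΦ.principal
  have hφa : IsSmoothAction 𝓘(ℝ, ℝ) (𝓡 n) φ := by
    obtain ⟨_, _, _, _, _, -, -, -, h⟩ := hφ.principal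
    exact h.isSmoothAction
  obtain ⟨B, hB⟩ := exists_reduced_poissonBracket hq hΦ.pullback
  obtain ⟨H₀, hH₀⟩ := hq.exists_descent hΦ.invariant
  let HG : C^∞⟮𝓡 m, P; ℝ⟯ := ⟨H₀, hq.contMDiff_of_comp (by simpa only [hH₀] using H.contMDiff)⟩
  have hHG : ∀ x, HG (q x) = H x := hH₀
  choose φP hφP using fun s => hq.exists_descent (F := fun x => q (φ s x))
    (fun b x => by rw [← hcomm, hq.proj_act])
  have hhom : IsHomogeneous φP HG := fun s y => by
    obtain ⟨x, rfl⟩ := hq.surjective y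
    rw [hφP, hHG, hHG, hφ.homogeneous]
  have hscale : ∀ (s : Λ) (F F' F₁ F₁' : C^∞⟮𝓡 m, P; ℝ⟯),
      (∀ x, F₁ x = F (φP s x)) → (∀ x, F₁' x = F' (φP s x)) →
      ∀ x, B.bracket F₁ F₁' x = scal s * B.bracket F F' (φP s x) := by
    intro s F F' F₁ F₁' h h' y
    obtain ⟨x, rfl⟩ := hq.surjective y
    rw [hφP, hB, hB]
    simp only [h, h', hφP]
    exact (hφ.pullback s).poisson_comp (hφa.contMDiff_act s) (hφa.contMDiff_act s⁻¹)
      (hφa.act_inv s) (hφa.inv_act s) (F.contMDiff.comp hq.contMDiff)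
      (F'.contMDiff.comp hq.contMDiff) x
  have hBhom : ∀ F F' : C^∞⟮𝓡 m, P; ℝ⟯, IsHomogeneous φP F → IsHomogeneous φP F' →
      IsHomogeneous φP (B.bracket F F') := by
    intro F F' h h' s y
    -- For homogeneous `F`, `F'` the functions `F ∘ φ_s`, `F' ∘ φ_s` are `sF`, `sF'`; one factor of
    -- `s²` then cancels.
    have h1 := hscale s F F' (scal s • F) (scal s • F') (fun x => (h s x).symm)
      (fun x => (h' s x).symm) y
    rw [map_smul, map_smul, LinearMap.smul_apply] at h1
    exact (mul_left_cancel₀ (scal_ne_zero s) h1).symm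
  -- The joint bundle only supplies the existence of an orbit manifold; the rest of the argument
  -- works over any base `K` of the reduced action.
  obtain ⟨d₀, K₀, _, _, pj, hK₀, hK₁, hK₂, hpj⟩ := hjoint
  obtain ⟨p₀, hp₀⟩ := hq.reduction hpj hφa hφP
  refine ⟨B, HG, φP, hB, hHG, hφP, ⟨⟨d₀, K₀, _, _, p₀, hK₀, hK₁, hK₂, hp₀⟩, hscale, hhom⟩, ?_⟩
  intro d K _ _ _ _ _ p hp
  have hπ : ContMDiff (𝓡 n) (𝓡 d) ∞ (fun y => p (q y)) := hp.contMDiff.comp hq.contMDiff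
  -- A single field serves as the projection of `X_{F ∘ q}` and as the operator `{F, ·}` on
  -- functions pulled back from `K`; this is what identifies projection and symbol in (3).
  have hproj : ∀ F : C^∞⟮𝓡 m, P; ℝ⟯, IsHomogeneous φP F → ∃ X : ∀ k : K, TangentSpace (𝓡 d) k,
      (IsSmoothVectorField X ∧ ∀ (f : C^∞⟮𝓡 d, K; ℝ⟯) y,
        vfDeriv X f (p y) = B.bracket F (pullbackFun hp f) y) ∧
      ∀ x : S, mfderiv (𝓡 n) (𝓡 d) (fun y => p (q y)) x
        (Ω.hamiltonianVF (fun y => F (q y)) x) = X (p (q x)) := by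
    intro F hF
    obtain ⟨X, hXs, hX⟩ := exists_projected_hamiltonianVF hq hΦ.pullback hφa hφ.pullback hφP hp hF
    refine ⟨X, ⟨hXs, fun f y => ?_⟩, hX⟩
    obtain ⟨x, rfl⟩ := hq.surjective y
    rw [hB, Ω.poisson_eq, vfDeriv, ← hX]
    exact (vfDeriv_comp _ f.contMDiff hπ x).symm
  let kir : KirillovBracket hp := kirillovOf hp B hBhom fun F hF =>
    (hproj F hF).imp fun _ h => h.1
  have hsec : ∀ F hF, homogeneousOf hp (sectionOf hp F hF) = F := homogeneousOf_sectionOf hp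
  refine ⟨hhom, kir, fun H₁ H₂ h₁ h₂ => ⟨hBhom H₁ H₂ h₁ h₂, ?_⟩, ?_⟩
  · refine homogeneousOf_injective hp ?_
    have h3 := homogeneousOf_dualBracket hp B hBhom (sectionOf hp H₁ h₁) (sectionOf hp H₂ h₂)
    rw [hsec, hsec] at h3
    refine h3.trans ?_
    rw [← neg_one_smul ℝ (sectionOf hp _ _), homogeneousOf_smul, hsec, neg_one_smul]
  · obtain ⟨X, ⟨hXs, hX⟩, hXp⟩ := hproj HG hhom
    have hsym : IsSymbol hp (fun h => kir.bracket h (sectionOf hp HG hhom)) X :=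
      isSymbol_dualBracket hp B hBhom _ (by simpa only [hsec] using hX)
    refine ⟨X, hXs, hsym, fun Y hY => hY.unique hsym, fun x => ?_⟩
    have h4 : (fun y => HG (q y)) = H := funext hHG
    rw [← hXp, h4]
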